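/- Consider ergodic (irreducible and aperiodic) time-reversible Markov chains on $n\ge 2$ states with transition probabilities $p_{uu'}$, stationary distribution $\pi$, $\frac14$-mixing time $\tau=\min\{t:\max_{\pi_0}\frac12\|\pi_0P^t-\pi\|_1\le\frac14\}$, and a target state $v$. An algorithm accesses the chain only through the queries $\mathrm{step}(u)$, which returns $u'$ with probability $p_{uu'}$, and $\mathrm{probe}(u,u')$, which returns $p_{uu'}$. A state is visited if it is $v$ or was returned by $\mathrm{step}$, and queries may be made only on visited states. Besides $v$ and $\epsilon,\delta$ the algorithm is given $n$ and $\tau$. Let $N_{v,T}$ be the number of distinct states visited by a random walk of $T$ steps starting from $v$. Let $\mathcal C$ be a class of such chains with target states, and let $\bar\tau$ be a real-valued function on it such that $$\Pr\big[N_{v,T}\notin\Theta(\mathbb E[N_{v,T}])\big]=o\big(\bar\tau/\mathbb E[N_{v,T}]\big)$$ on $\mathcal C$, i.e. there are $c_1,c_2>0$ such that for every $\eta>0$ there is an $L$ such that, for all chains in $\mathcal C$ with $n\ge L$ and all $T$ with $\mathbb E[N_{v,T}]\ge L\bar\tau$, the probability that $N_{v,T}\notin[c_1\mathbb E[N_{v,T}],c_2\mathbb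 E[N_{v,T}]]$ is at most $\eta\,\bar\tau/\mathbb E[N_{v,T}]$. (1) There is an algorithm, the same for all $\mathcal C$ and $\bar\tau$, such that whenever moreover $\bar\tau=\Omega(\tau)$ on $\mathcal C$, there is a function $f$ of $(\epsilon,\delta)$ with the following property: for all $\epsilon,\delta\in(0,1)$ and every chain in $\mathcal C$, with probability at least $1-\delta$ the algorithm returns a value in $[(1-\epsilon)\pi(v),(1+\epsilon)\pi(v)]$ and visits at most $f(\epsilon,\delta)\,(\tau\ln n+\sqrt{\bar\tau n})$ distinct states. (2) If moreover $\bar\tau=\Omega(\tau\ln n)$ on $\mathcal C$, then the following algorithm FullMassApprox has this property, with sampling interval $t=\lceil\kappa(\epsilon,\delta)\,\tau\ln n\rceil$ for a function $\kappa$ that does not depend on $\mathcal C$ and $\bar\tau$. Put $S=\{v\}$, $\gamma_v=1$, $w=r=0$, $u=v$ and $k=4\lceil\frac{2+4.4\epsilon}{\epsilon^2}\ln\frac3\delta\rceil$. While $r<k$: add $\sum_{x\in S}\gamma_x$ to $w$; make $t$ steps of the walk from $u$, setting $\gamma_{u'}=\gamma_{x}\,p_{xu'}/p_{u'x}$ whenever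 a step from $x$ reaches a never visited state $u'$, and let $u$ be the last state reached; if $u\in S$, increase $r$ by $1$; then add all states visited in these $t$ steps to $S$. Return $r/w$. -/

import Mathlib

open Matrix

noncomputable section

/-- An ergodic (irreducible and aperiodic) time-reversible Markov chain on the finite state space
`V`: its transition matrix `P` is row-stochastic and primitive, and `π` is its (unique) stationary
distribution, which satisfies the detailed balance equations. -/
structure ReversibleChain (V : Type) [Fintype V] [DecidableEq V] where
  /-- transition matrix -/
  P : Matrix V V ℝ
  /-- stationary distribution -/
  π : V → ℝ
  stochastic : P ∈ rowStochastic ℝ V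
  ergodic : P.IsPrimitive
  distribution : π ∈ stdSimplex ℝ V
  stationary : π ᵥ* P = π
  reversible : ∀ u w, π u * P u w = π w * P w u

namespace ReversibleChain

variable {V : Type} [Fintype V] [DecidableEq V]

/-- `d(t)`: the largest total variation distance to stationarity after `t` steps, over all initial
distributions. -/
def dist (c : ReversibleChain V) (t : ℕ) : ℝ :=
  ⨆ μ : stdSimplex ℝ V, (1 / 2) * ∑ u, |((μ : V → ℝ) ᵥ* c.P ^ t) u - c.π u|

/-- The `1/4`-mixing time `τ = min {t : d(t) ≤ 1/4}`. -/
def mixingTime (c : ReversibleChain V) : ℕ :=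
  sInf {t : ℕ | c.dist t ≤ 1 / 4}

end ReversibleChain

/-- Algorithms that access a chain on `V` only through queries.  At each point the algorithm stops
with an output, or calls `step u` and continues according to the state returned, or calls
`probe u u'` and continues according to the number returned. -/
inductive QueryAlg (V : Type) : Type where
  | output (x : ℝ) : QueryAlg V
  | step (u : V) (next : V → QueryAlg V) : QueryAlg V
  | probe (u u' : V) (next : ℝ → QueryAlg V) : QueryAlg V

namespace QueryAlg

variable {V : Type}

/-- The locality constraint: `step` and `probe` are invoked only on visited states.  The second
argument is the set of states visited so far; a state returned by `step` becomes visited. -/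
def IsLocal [DecidableEq V] : QueryAlg V → Finset V → Prop
  | output _, _ => True
  | step u next, S => u ∈ S ∧ ∀ w, (next w).IsLocal (insert w S)
  | probe u u' next, S => u ∈ S ∧ u' ∈ S ∧ ∀ p, (next p).IsLocal S

/-- Expectation of `g (output) (set of visited states)` when the algorithm is run on the chain `c`
and the states in `S` have been visited before.  A call `step u` returns `w` with probability
`P u w`, independently of the past; a call `probe u u'` returns `P u u'`. -/
def expect [Fintype V] [DecidableEq V] (c : ReversibleChain V) (g : ℝ → Finset V → ℝ) :
    QueryAlg V → Finset V → ℝ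
  | output x, S => g x S
  | step u next, S => ∑ w, c.P u w * (next w).expect c g (insert w S)
  | probe u u' next, S => (next (c.P u u')).expect c g S

open Classical in
/-- Probability of the event `E (output) (set of visited states)` when the algorithm is run on the
chain `c` for the target state `v`, which is visited at the outset. -/
def prob [Fintype V] [DecidableEq V] (c : ReversibleChain V) (v : V) (A : QueryAlg V)
    (E : ℝ → Finset V → Prop) : ℝ :=
  A.expect c (fun x S => if E x S then 1 else 0) {v}

/-- The plain random walk of `T` steps from `u` (its output is irrelevant). -/
def walk : ℕ → V → QueryAlg V
  | 0, _ => output 0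
  | T + 1, u => step u (fun w => walk T w)

end QueryAlg

/-- `E[N_{v,T}]`, where `N_{v,T}` is the number of distinct states visited by a random walk of `T`
steps starting from `v`. -/
def expectedVisits {V : Type} [Fintype V] [DecidableEq V] (c : ReversibleChain V) (v : V)
    (T : ℕ) : ℝ :=
  (QueryAlg.walk T v).expect c (fun _ S => (S.card : ℝ)) {v}

/-! ### The algorithm FullMassApprox -/

namespace FullMassApprox

variable {V : Type} [DecidableEq V]

/-- The inner loop: `t` steps of the walk from the current state `u`.  The dictionary `D` maps each
state visited so far to the ratio of its stationary mass to that of the target state (`none` means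
never visited), and `N` collects the newly visited states.  The algorithm then goes on with `cont`,
given the final values of `u`, `D`, `N`. -/
def inner : ℕ → V → (V → Option ℝ) → Finset V →
    (V → (V → Option ℝ) → Finset V → QueryAlg V) → QueryAlg V
  | 0, u, D, N, cont => cont u D N
  | t + 1, u, D, N, cont =>
    .step u fun w =>
      if D w = none then
        .probe u w fun p => .probe w u fun q =>
          inner t w (Function.update D w (some ((D u).getD 0 * p / q))) (insert w N) cont
      else inner t w D N cont

/-- The outer loop, run while the number `r` of repeats is below `k`.  `S` is the set of states
visited before the current pass, `wS` the sum of the ratios over `S`, and `w` the accumulated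
value of `wS`.  The first argument bounds the number of passes, for structural recursion only. -/
def outer (k t : ℕ) : ℕ → Finset V → (V → Option ℝ) → ℝ → ℝ → ℕ → V → QueryAlg V
  | 0, _, _, _, _, _, _ => .output 0
  | fuel + 1, S, D, wS, w, r, u =>
    if r < k then
      inner t u D ∅ fun u' D' N =>
        outer k t fuel (S ∪ N) D' (wS + ∑ x ∈ N, (D' x).getD 0) (w + wS)
          (if u' ∈ S then r + 1 else r) u'
    else .output (r / w)

/-- The halting threshold on the number of repeats. -/
def threshold (ε δ : ℝ) : ℕ :=
  4 * ⌈(2 + 4.4 * ε) / ε ^ 2 * Real.log (3 / δ)⌉₊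

/-- FullMassApprox for the target state `v`, taking a sample every `t` steps of one long walk.
In each pass of the outer loop either `r` increases or `S` gains a state, so that there are at most
`|V| - 1 + k` passes, and the bound `|V| + k` on the number of passes is never met. -/
def alg [Fintype V] (t : ℕ) (ε δ : ℝ) (v : V) : QueryAlg V :=
  outer (threshold ε δ) t (Fintype.card V + threshold ε δ) {v}
    (Function.update (fun _ => none) v (some 1)) 1 0 0 v

end FullMassApprox

/-! ### Classes of chains and the asymptotic statements -/

/-- An ergodic time-reversible chain on `n ≥ 2` states with a target state. -/
structure TargetChain where
  n : ℕ
  two_le : 2 ≤ n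
  chain : ReversibleChain (Fin n)
  target : Fin n

/-- `E[N_{v,T}]` for the target state `v`. -/
def TargetChain.visits (X : TargetChain) (T : ℕ) : ℝ :=
  expectedVisits X.chain X.target T

/-- The concentration hypothesis `Pr[N_{v,T} ∉ Θ(E N_{v,T})] = o(τ̄ / E N_{v,T})` on a class of
chains: with constants `c₁, c₂` of the `Θ` that are common to the class, for each `η > 0` the
probability is at most `η τ̄ / E N_{v,T}` for all large `n` and all `T` such that `E N_{v,T} / τ̄`
is large. -/
def VisitsConcentrate (𝒞 : Set TargetChain) (τbar : TargetChain → ℝ) : Prop :=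
  ∃ c₁ > (0 : ℝ), ∃ c₂ > (0 : ℝ), ∀ η > (0 : ℝ), ∃ L : ℝ, ∀ X ∈ 𝒞, L ≤ X.n →
    ∀ T : ℕ, L * τbar X ≤ X.visits T →
      (QueryAlg.walk T X.target).prob X.chain X.target
        (fun _ S => ¬ (c₁ * X.visits T ≤ S.card ∧ S.card ≤ c₂ * X.visits T))
      ≤ η * (τbar X / X.visits T)

/-- A scheme of algorithms: the algorithm may depend on the number `n` of states, on the mixing time
`τ`, on `ε`, `δ` and the target state, and on nothing else. -/
abbrev Scheme : Type :=
  (n τ : ℕ) → (ε δ : ℝ) → (v : Fin n) → QueryAlg (Fin n)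

/-- All algorithms of the scheme obey the locality constraint. -/
def Scheme.IsLocal (A : Scheme) : Prop :=
  ∀ (n τ : ℕ) (ε δ : ℝ) (v : Fin n), (A n τ ε δ v).IsLocal {v}

/-- On every chain of the class, for all `ε, δ ∈ (0,1)`, with probability at least `1 - δ` the
scheme returns a `(1 ± ε)`-approximation of `π(v)` and visits at most
`f(ε,δ) (τ ln n + √(τ̄ n))` distinct states. -/
def Scheme.Achieves (A : Scheme) (𝒞 : Set TargetChain) (τbar : TargetChain → ℝ) : Prop :=
  ∃ f : ℝ → ℝ → ℝ, ∀ ε ∈ Set.Ioo (0 : ℝ) 1, ∀ δ ∈ Set.Ioo (0 : ℝ) 1, ∀ X ∈ 𝒞,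
    1 - δ ≤ (A X.n X.chain.mixingTime ε δ X.target).prob X.chain X.target
      (fun x S =>
        ((1 - ε) * X.chain.π X.target ≤ x ∧ x ≤ (1 + ε) * X.chain.π X.target) ∧
        (S.card : ℝ) ≤
          f ε δ * (X.chain.mixingTime * Real.log X.n + √(τbar X * X.n)))

/-- The scheme that runs FullMassApprox and takes a sample every `⌈κ(ε,δ) τ ln n⌉` steps. -/
def fullMassApproxScheme (κ : ℝ → ℝ → ℝ) : Scheme := fun n τ ε δ v =>
  FullMassApprox.alg ⌈κ ε δ * τ * Real.log n⌉₊ ε δ v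

end

/-! Both algorithms compare two running totals: the number of samples that land in a set of states
visited earlier (`hits`), and the sum of the stationary masses of the sets tested (`mass`). Detailed
balance gives `π x / π v` exactly for every visited `x`, so the second total is known up to the
factor `π v`. A sample of a well mixed walk hits a set of mass `p` with probability close to `p`.
When the count reaches `k`, the accumulated mass is therefore close to `k`, and the quotient
approximates `π v`.

Accuracy. A deterministic number of samples always produces `k` hits (`le_hits`). If the sets are
emptied once the accumulated mass passes `k / (1 ± ε)`, a wrong answer becomes a deviation between
hits and mass at a fixed time, with bounded mass (`le_ex_outcome`). In FullMassApprox, samples are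
of order `τ ln n` steps apart, so centred hits are almost martingale differences and a Chernoff
bound applies (`ex_pow_hitsIn_le`). If only `τ̄ = Ω(τ)`, the interval has to be `O(τ)`, which is too
short to mix. `laggedScheme` then samples every `τ` steps, but tests each sample against the set
visited `O(ln n)` samples before, for fixed `ε, δ`. Lags overlap, so there is no martingale; but
correlations decay geometrically, the variance is of the order of the mass
(`ex_sq_hitsIn_sub_massIn_le`), and Chebyshev's inequality suffices.

Cost (`exists_visits_bound`). Let `B` be a large multiple of `τ ln n + √(τ̄ n)` and `T₁` the first
time with `E N ≥ B`. By the concentration hypothesis about `B` states are visited by then. States of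
mass below some `θ` of order `B / (T₁ n)` carry too little mass to make up half of them, so the
visited set has mass of order `B² / (T₁ n)`. The mass level `k / (1 - ε)` is then reached within
`O(T₁ n / B²)` further samples; since the interval is `O(τ̄)` and `B²` is a large multiple of `τ̄
n`, these take at most `T₁ + 1` steps. Finally `E N_{2T} ≤ 2 E N_T + O(τ ln n)`, by subadditivity
and mixing (`expectedVisits_two_mul_le`), and Markov's inequality bounds the number of visited
states. -/

noncomputable section

namespace ReversibleChain

variable {V : Type} [Fintype V] [DecidableEq V] (c : ReversibleChain V)

/-! ### Stationarity and positivity -/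

lemma pow_stochastic (s : ℕ) : c.P ^ s ∈ rowStochastic ℝ V := pow_mem c.stochastic s

lemma P_nonneg (x y : V) : 0 ≤ c.P x y := nonneg_of_mem_rowStochastic c.stochastic

lemma P_sum (x : V) : ∑ y, c.P x y = 1 := sum_row_of_mem_rowStochastic c.stochastic x

lemma π_nonneg (x : V) : 0 ≤ c.π x := c.distribution.1 x

lemma π_sum : ∑ x, c.π x = 1 := c.distribution.2

lemma π_vecMul_pow (s : ℕ) : c.π ᵥ* c.P ^ s = c.π := by
  induction s with
  | zero => simp
  | succ s ih => rw [pow_succ, ← vecMul_vecMul, ih, c.stationary]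

lemma π_dotProduct_pow_mulVec (s : ℕ) (f : V → ℝ) : c.π ⬝ᵥ (c.P ^ s *ᵥ f) = c.π ⬝ᵥ f := by
  rw [dotProduct_mulVec, c.π_vecMul_pow]

lemma π_pos (x : V) : 0 < c.π x := by
  obtain ⟨k, -, hk⟩ := c.ergodic.2
  have h : c.π x = ∑ y, c.π y * (c.P ^ k) y x := by
    conv_lhs => rw [← c.π_vecMul_pow k]
    rfl
  obtain ⟨y, hy⟩ : ∃ y, 0 < c.π y := by
    by_contra! hc
    have : ∑ y, c.π y ≤ 0 := Finset.sum_nonpos fun y _ => hc y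
    linarith [c.π_sum]
  rw [h]
  exact Finset.sum_pos' (fun z _ => mul_nonneg (c.π_nonneg z) (hk z x).le)
    ⟨y, Finset.mem_univ _, mul_pos hy (hk y x)⟩

lemma abs_sub_dotProduct_π_le {f : V → ℝ} {b : ℝ} (hf : ∀ x y, f x - f y ≤ b) (x : V) :
    |f x - c.π ⬝ᵥ f| ≤ b := by
  have h : f x - c.π ⬝ᵥ f = ∑ y, c.π y * (f x - f y) := by
    simp only [mul_sub, Finset.sum_sub_distrib, ← Finset.sum_mul, c.π_sum, one_mul, dotProduct]
  rw [h]
  calc |∑ y, c.π y * (f x - f y)| ≤ ∑ y, |c.π y * (f x - f y)| := Finset.abs_sum_le_sum_abs _ _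
    _ ≤ ∑ y, c.π y * b := by
        refine Finset.sum_le_sum fun y _ => ?_
        rw [abs_mul, abs_of_nonneg (c.π_nonneg y)]
        refine mul_le_mul_of_nonneg_left (abs_le.2 ⟨?_, hf x y⟩) (c.π_nonneg y)
        linarith [hf y x]
    _ = b := by rw [← Finset.sum_mul, c.π_sum, one_mul]

/-! ### Contraction of oscillations -/

/-- A row-stochastic matrix whose entries are at least `η` contracts oscillations by `1 - η`. -/
lemma osc_mulVec_le {Q : Matrix V V ℝ} (hQ : Q ∈ rowStochastic ℝ V) {η : ℝ}
    (hη : ∀ x y, η ≤ Q x y) (hη1 : η ≤ 1) {f : V → ℝ} {b : ℝ} (hf : ∀ x y, f x - f y ≤ b) (x y : V) :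
    (Q *ᵥ f) x - (Q *ᵥ f) y ≤ (1 - η) * b := by
  obtain ⟨p, hp⟩ := @Finite.exists_max V ℝ _ ⟨x⟩ _ f
  obtain ⟨q, hq⟩ := @Finite.exists_min V ℝ _ ⟨x⟩ _ f
  -- Both rows give weight at least `η` to the same state `x`. This pulls one average below the
  -- maximum and lifts the other above the minimum; the two gains add up to `η (f p - f q)`.
  have hx : η * (f p - f x) ≤ f p - (Q *ᵥ f) x := by
    have h : f p - (Q *ᵥ f) x = ∑ u, Q x u * (f p - f u) := by
      simp only [mul_sub, Finset.sum_sub_distrib, ← Finset.sum_mul,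
        sum_row_of_mem_rowStochastic hQ, one_mul, mulVec, dotProduct]
    rw [h]
    refine le_trans ?_ (Finset.single_le_sum (fun u _ => mul_nonneg
      (nonneg_of_mem_rowStochastic hQ) (sub_nonneg.2 (hp u))) (Finset.mem_univ x))
    exact mul_le_mul_of_nonneg_right (hη _ _) (sub_nonneg.2 (hp x))
  have hy : η * (f x - f q) ≤ (Q *ᵥ f) y - f q := by
    have h : (Q *ᵥ f) y - f q = ∑ u, Q y u * (f u - f q) := by
      simp only [mul_sub, Finset.sum_sub_distrib, ← Finset.sum_mul,
        sum_row_of_mem_rowStochastic hQ, one_mul, mulVec, dotProduct]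
    rw [h]
    refine le_trans ?_ (Finset.single_le_sum (fun u _ => mul_nonneg
      (nonneg_of_mem_rowStochastic hQ) (sub_nonneg.2 (hq u))) (Finset.mem_univ x))
    exact mul_le_mul_of_nonneg_right (hη _ _) (sub_nonneg.2 (hq x))
  nlinarith [mul_le_mul_of_nonneg_left (hf p q) (sub_nonneg.2 hη1)]

lemma osc_pow_mulVec_le (s : ℕ) {f : V → ℝ} {b : ℝ} (hf : ∀ x y, f x - f y ≤ b) (x y : V) :
    (c.P ^ s *ᵥ f) x - (c.P ^ s *ᵥ f) y ≤ b := by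
  have := osc_mulVec_le (c.pow_stochastic s) (η := 0)
    (fun _ _ => nonneg_of_mem_rowStochastic (c.pow_stochastic s)) zero_le_one hf x y
  simpa using this

/-! ### The mixing time -/

lemma dist_le_of_forall {t : ℕ} {b : ℝ} [Nonempty V]
    (h : ∀ μ : stdSimplex ℝ V, (1 / 2) * ∑ u, |((μ : V → ℝ) ᵥ* c.P ^ t) u - c.π u| ≤ b) :
    c.dist t ≤ b := by
  have : Nonempty (stdSimplex ℝ V) := ⟨⟨c.π, c.distribution⟩⟩
  exact ciSup_le h

lemma le_dist (t : ℕ) (μ : stdSimplex ℝ V) :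
    (1 / 2) * ∑ u, |((μ : V → ℝ) ᵥ* c.P ^ t) u - c.π u| ≤ c.dist t := by
  refine le_ciSup (f := fun μ : stdSimplex ℝ V =>
    (1 / 2) * ∑ u, |((μ : V → ℝ) ᵥ* c.P ^ t) u - c.π u|) ⟨1, ?_⟩ μ
  rintro _ ⟨ν, rfl⟩
  have hν : ∀ u, 0 ≤ ((ν : V → ℝ) ᵥ* c.P ^ t) u := fun u =>
    Finset.sum_nonneg fun x _ => mul_nonneg (ν.2.1 x)
      (nonneg_of_mem_rowStochastic (c.pow_stochastic t))
  have hs : ∑ u, ((ν : V → ℝ) ᵥ* c.P ^ t) u = 1 := by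
    simp only [vecMul, dotProduct]
    rw [Finset.sum_comm]
    simp only [← Finset.mul_sum, sum_row_of_mem_rowStochastic (c.pow_stochastic t), mul_one]
    exact ν.2.2
  have : ∑ u, |((ν : V → ℝ) ᵥ* c.P ^ t) u - c.π u| ≤
      ∑ u, (((ν : V → ℝ) ᵥ* c.P ^ t) u + c.π u) := by
    refine Finset.sum_le_sum fun u _ => ?_
    rw [abs_le]
    constructor <;> linarith [hν u, c.π_nonneg u]
  rw [Finset.sum_add_distrib, hs, c.π_sum] at this
  linarith

/-- Doeblin's argument: primitivity provides a power with all entries at least some `η > 0`, and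
each such block of steps contracts oscillations by `1 - η`. This makes the set in the definition of
`mixingTime` nonempty, so that its infimum is attained. -/
lemma exists_dist_le [Nonempty V] {b : ℝ} (hb : 0 < b) : ∃ t, c.dist t ≤ b := by
  obtain ⟨k, -, hk⟩ := c.ergodic.2
  obtain ⟨⟨x₀, y₀⟩, h₀⟩ := Finite.exists_min fun z : V × V => (c.P ^ k) z.1 z.2
  set η := (c.P ^ k) x₀ y₀
  have hη0 : 0 < η := hk _ _
  have hη1 : η ≤ 1 := le_one_of_mem_rowStochastic (c.pow_stochastic k)
  have hosc : ∀ (j : ℕ) (f : V → ℝ), (∀ x y, f x - f y ≤ 1) → ∀ x y,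
      (c.P ^ (k * j) *ᵥ f) x - (c.P ^ (k * j) *ᵥ f) y ≤ (1 - η) ^ j := by
    intro j f hf
    induction j with
    | zero => simpa using hf
    | succ j ih =>
      intro x y
      have := osc_mulVec_le (c.pow_stochastic k) (fun x y => h₀ (x, y)) hη1 ih x y
      rwa [mulVec_mulVec, ← pow_add, show k + k * j = k * (j + 1) by ring, ← pow_succ'] at this
  have hcard : (0 : ℝ) < Fintype.card V := by exact_mod_cast Fintype.card_pos
  obtain ⟨j, hj⟩ := exists_pow_lt_of_lt_one (div_pos hb hcard) (sub_lt_self 1 hη0)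
  refine ⟨k * j, c.dist_le_of_forall fun μ => ?_⟩
  have hμ0 : ∀ x, 0 ≤ μ x := μ.2.1
  have hμ1 : ∑ x, μ x = 1 := μ.2.2
  have key : ∀ u, |((μ : V → ℝ) ᵥ* c.P ^ (k * j)) u - c.π u| ≤ (1 - η) ^ j := by
    intro u
    set f : V → ℝ := Pi.single u 1
    have hf : ∀ x y, f x - f y ≤ 1 := by
      intro x y
      by_cases hx : x = u <;> by_cases hy : y = u <;> simp [f, hx, hy]
    have h1 : ∀ x, |(c.P ^ (k * j) *ᵥ f) x - c.π ⬝ᵥ f| ≤ (1 - η) ^ j := by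
      intro x
      rw [← c.π_dotProduct_pow_mulVec (k * j) f]
      exact c.abs_sub_dotProduct_π_le (hosc j f hf) x
    have h2 : ((μ : V → ℝ) ᵥ* c.P ^ (k * j)) u - c.π u =
        ∑ x, μ x * ((c.P ^ (k * j) *ᵥ f) x - c.π ⬝ᵥ f) := by
      simp only [mul_sub, Finset.sum_sub_distrib, ← Finset.sum_mul, hμ1, one_mul]
      simp [f, vecMul, dotProduct_single]
      simp [dotProduct]
    rw [h2]
    refine (Finset.abs_sum_le_sum_abs _ _).trans ?_
    calc _ ≤ ∑ x, μ x * (1 - η) ^ j := by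
            refine Finset.sum_le_sum fun x _ => ?_
            rw [abs_mul, abs_of_nonneg (hμ0 x)]
            exact mul_le_mul_of_nonneg_left (h1 x) (hμ0 x)
      _ = _ := by rw [← Finset.sum_mul, hμ1, one_mul]
  have hsum : ∑ u, |((μ : V → ℝ) ᵥ* c.P ^ (k * j)) u - c.π u| ≤ b := by
    refine (Finset.sum_le_sum fun u _ => key u).trans ?_
    rw [Finset.sum_const, nsmul_eq_mul, Finset.card_univ]
    rw [lt_div_iff₀ hcard] at hj
    linarith
  have : 0 ≤ ∑ u, |((μ : V → ℝ) ᵥ* c.P ^ (k * j)) u - c.π u| :=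
    Finset.sum_nonneg fun _ _ => abs_nonneg _
  linarith

lemma dist_mixingTime_le [Nonempty V] : c.dist c.mixingTime ≤ 1 / 4 :=
  Nat.sInf_mem (s := {t : ℕ | c.dist t ≤ 1 / 4}) (c.exists_dist_le (by norm_num))

/-- Both measures have total mass one, so `f` may be centred at the midpoint of its range. It is
then at most `b / 2` in absolute value, and the `ℓ¹` distance is twice the total variation distance.
-/
lemma abs_pow_mulVec_sub_le (t : ℕ) {f : V → ℝ} {b : ℝ} (hf : ∀ x y, f x - f y ≤ b) (x : V) :
    |(c.P ^ t *ᵥ f) x - c.π ⬝ᵥ f| ≤ c.dist t * b := by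
  obtain ⟨p, hp⟩ := @Finite.exists_max V ℝ _ ⟨x⟩ _ f
  obtain ⟨q, hq⟩ := @Finite.exists_min V ℝ _ ⟨x⟩ _ f
  have h : (1 / 2) * ∑ u, |((Pi.single x 1 : V → ℝ) ᵥ* c.P ^ t) u - c.π u| ≤ c.dist t :=
    c.le_dist t ⟨Pi.single x 1, single_mem_stdSimplex ℝ x⟩
  simp only [single_vecMul, one_smul] at h
  have e : (c.P ^ t *ᵥ f) x - c.π ⬝ᵥ f =
      ∑ u, ((c.P ^ t) x u - c.π u) * (f u - (f p + f q) / 2) := by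
    simp only [mul_sub, sub_mul, Finset.sum_sub_distrib, ← Finset.sum_mul, c.π_sum,
      sum_row_of_mem_rowStochastic (c.pow_stochastic t), mulVec, dotProduct]
    ring
  rw [e]
  refine (Finset.abs_sum_le_sum_abs _ _).trans ?_
  calc _ ≤ ∑ u, |(c.P ^ t) x u - c.π u| * (b / 2) := by
        refine Finset.sum_le_sum fun u _ => ?_
        rw [abs_mul]
        refine mul_le_mul_of_nonneg_left (abs_le.2 ⟨?_, ?_⟩) (abs_nonneg _) <;>
          linarith [hp u, hq u, hf p q]
    _ = ((1 / 2) * ∑ u, |(c.P ^ t) x u - c.π u|) * b := by rw [← Finset.sum_mul]; ring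
    _ ≤ _ := by
        refine mul_le_mul_of_nonneg_right h ?_
        linarith [hf x x]

/-- Oscillations are halved in each period of length `τ`. -/
lemma osc_pow_mulVec_le_pow (s : ℕ) {f : V → ℝ} {b : ℝ} (hf : ∀ x y, f x - f y ≤ b) (x y : V) :
    (c.P ^ s *ᵥ f) x - (c.P ^ s *ᵥ f) y ≤ (1 / 2) ^ (s / c.mixingTime) * b := by
  have : Nonempty V := ⟨x⟩
  have hb : 0 ≤ b := by linarith [hf x x]
  have hosc : ∀ (j : ℕ), ∀ x y, (c.P ^ (c.mixingTime * j) *ᵥ f) x -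
      (c.P ^ (c.mixingTime * j) *ᵥ f) y ≤ (1 / 2) ^ j * b := by
    intro j
    induction j with
    | zero => simpa using hf
    | succ j ih =>
      intro x y
      -- Two values within a quarter of the oscillation of the same mean differ by at most half of
      -- it.
      have h1 := abs_le.1 (c.abs_pow_mulVec_sub_le c.mixingTime ih x)
      have h2 := abs_le.1 (c.abs_pow_mulVec_sub_le c.mixingTime ih y)
      have h3 : c.dist c.mixingTime * ((1 / 2) ^ j * b) ≤ 1 / 4 * ((1 / 2) ^ j * b) :=
        mul_le_mul_of_nonneg_right c.dist_mixingTime_le (by positivity)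
      rw [mulVec_mulVec, ← pow_add,
        show c.mixingTime + c.mixingTime * j = c.mixingTime * (j + 1) by ring] at h1 h2
      rw [pow_succ]
      linarith [h1.2, h2.1]
  have h := c.osc_pow_mulVec_le (s % c.mixingTime) (hosc (s / c.mixingTime)) x y
  rwa [mulVec_mulVec, ← pow_add, Nat.mod_add_div] at h

/-- A bound on the distance to stationarity that halves in each period of length `τ`. -/
def mixErr (s : ℕ) : ℝ := (1 / 2) ^ (s / c.mixingTime)

lemma mixErr_nonneg (s : ℕ) : 0 ≤ c.mixErr s := by unfold mixErr; positivity

lemma mixErr_anti : Antitone c.mixErr := fun _ _ h =>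
  pow_le_pow_of_le_one (by norm_num) (by norm_num) (Nat.div_le_div_right h)

lemma abs_pow_mulVec_sub_le_mixErr (s : ℕ) {f : V → ℝ} {b : ℝ} (hf : ∀ x y, f x - f y ≤ b)
    (x : V) : |(c.P ^ s *ᵥ f) x - c.π ⬝ᵥ f| ≤ c.mixErr s * b := by
  rw [← c.π_dotProduct_pow_mulVec s f]
  exact c.abs_sub_dotProduct_π_le (c.osc_pow_mulVec_le_pow s hf) x

/-- A point mass at `x` has distance `1 - π x` from stationarity, and two states cannot both have
mass at least `3/4`. -/
lemma mixingTime_pos (h2 : 2 ≤ Fintype.card V) : 0 < c.mixingTime := by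
  have : Nontrivial V := Fintype.one_lt_card_iff_nontrivial.1 h2
  rw [Nat.pos_iff_ne_zero]
  intro h0
  obtain ⟨x, y, hxy⟩ := exists_pair_ne V
  have hd := c.dist_mixingTime_le
  rw [h0] at hd
  have hkey : ∀ z, 1 - c.π z ≤ 1 / 4 := by
    intro z
    have hf : ∀ x y, (Pi.single z (1 : ℝ) : V → ℝ) x - (Pi.single z (1 : ℝ) : V → ℝ) y ≤ 1 := by
      intro x y
      by_cases hx : x = z <;> by_cases hy : y = z <;> simp [hx, hy]
    have h := c.abs_pow_mulVec_sub_le 0 hf z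
    simp only [pow_zero, one_mulVec, Pi.single_eq_same, dotProduct_single, mul_one] at h
    exact (le_abs_self _).trans (h.trans hd)
  have := Finset.add_le_sum (s := Finset.univ) (f := c.π) (fun i _ => c.π_nonneg i)
    (Finset.mem_univ x) (Finset.mem_univ y) hxy
  linarith [hkey x, hkey y, c.π_sum]

/-- A geometric series in blocks of length `τ`. -/
lemma sum_mixErr_le (hτ : 0 < c.mixingTime) (S : ℕ) :
    ∑ s ∈ Finset.range S, c.mixErr s ≤ 2 * c.mixingTime := by
  have hblock : ∀ m : ℕ, ∑ s ∈ Finset.range (m * c.mixingTime), c.mixErr s =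
      c.mixingTime * (2 - 2 * (1 / 2) ^ m) := by
    intro m
    induction m with
    | zero => simp
    | succ m ih =>
      rw [Nat.succ_mul, Finset.sum_range_add, ih]
      have : ∀ r ∈ Finset.range c.mixingTime, c.mixErr (m * c.mixingTime + r) = (1 / 2) ^ m := by
        intro r hr
        rw [mixErr, mul_comm, Nat.mul_add_div hτ, Nat.div_eq_of_lt (Finset.mem_range.1 hr),
          add_zero]
      rw [Finset.sum_congr rfl this, Finset.sum_const, Finset.card_range, nsmul_eq_mul, pow_succ]
      ring
  calc ∑ s ∈ Finset.range S, c.mixErr s ≤ ∑ s ∈ Finset.range (S * c.mixingTime), c.mixErr s :=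
        Finset.sum_le_sum_of_subset_of_nonneg
          (Finset.range_mono (Nat.le_mul_of_pos_right S hτ)) fun s _ _ => c.mixErr_nonneg s
    _ ≤ 2 * c.mixingTime := by
        rw [hblock]
        have : (0 : ℝ) ≤ c.mixingTime * (2 * (1 / 2) ^ S) := by positivity
        linarith

end ReversibleChain

namespace ReversibleChain

lemma update_agree {V : Type} {ω ω' : ℕ → V} {i : ℕ} {w : V}
    (h : ∀ s ≤ i + 1, ω' s = Function.update ω (i + 1) w s) : ∀ s ≤ i, ω' s = ω s := by
  intro s hs
  rw [h s (by omega), Function.update_of_ne (by omega)]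

/-- Backward induction over the time interval `[i, j]`. -/
lemma backward_induction {j : ℕ} {motive : ℕ → Prop} (base : ∀ i, j ≤ i → motive i)
    (step : ∀ i, i < j → motive (i + 1) → motive i) (i : ℕ) : motive i := by
  obtain h | h := le_total j i
  · exact base i h
  · exact Nat.decreasingInduction (motive := fun m _ => motive m) (fun k hk ih => step k hk ih)
      (base j le_rfl) h

variable {V : Type} [Fintype V] [DecidableEq V] (c : ReversibleChain V)

/-! ### Expectations over trajectories -/

/-- Expectation of `F` over the trajectories that follow `ω` up to time `i` and then take `T` steps
of the chain (and agree with `ω` again afterwards). -/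
def pathExp : ℕ → ℕ → (ℕ → V) → ((ℕ → V) → ℝ) → ℝ
  | 0, _, ω, F => F ω
  | T + 1, i, ω, F => ∑ w, c.P (ω i) w * pathExp T (i + 1) (Function.update ω (i + 1) w) F

/-- Conditional expectation of `F` given the trajectory `ω` up to time `i`, where `F` is evaluated
on trajectories that follow the chain up to time `j`. -/
def ex (i j : ℕ) (ω : ℕ → V) (F : (ℕ → V) → ℝ) : ℝ := c.pathExp (j - i) i ω F

lemma ex_of_le {i j : ℕ} (h : j ≤ i) (ω : ℕ → V) (F : (ℕ → V) → ℝ) : c.ex i j ω F = F ω := by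
  rw [ex, Nat.sub_eq_zero_of_le h, pathExp]

lemma ex_step {i j : ℕ} (h : i < j) (ω : ℕ → V) (F : (ℕ → V) → ℝ) :
    c.ex i j ω F = ∑ w, c.P (ω i) w * c.ex (i + 1) j (Function.update ω (i + 1) w) F := by
  rw [ex, show j - i = (j - (i + 1)) + 1 by omega, pathExp]
  rfl

lemma ex_mono {i j : ℕ} {ω : ℕ → V} {F G : (ℕ → V) → ℝ}
    (h : ∀ ω', (∀ s ≤ i, ω' s = ω s) → F ω' ≤ G ω') : c.ex i j ω F ≤ c.ex i j ω G := by
  induction i using backward_induction (j := j) generalizing ω with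
  | base i hi => rw [c.ex_of_le hi, c.ex_of_le hi]; exact h ω fun _ _ => rfl
  | step i hi ih =>
    rw [c.ex_step hi, c.ex_step hi]
    exact Finset.sum_le_sum fun w _ => mul_le_mul_of_nonneg_left
      (ih fun ω' hω' => h ω' (update_agree hω')) (c.P_nonneg _ _)

lemma ex_congr {i j : ℕ} {ω : ℕ → V} {F G : (ℕ → V) → ℝ}
    (h : ∀ ω', (∀ s ≤ i, ω' s = ω s) → F ω' = G ω') : c.ex i j ω F = c.ex i j ω G :=
  le_antisymm (c.ex_mono fun ω' hω' => (h ω' hω').le) (c.ex_mono fun ω' hω' => (h ω' hω').ge)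

lemma ex_const (i j : ℕ) (ω : ℕ → V) (a : ℝ) : c.ex i j ω (fun _ => a) = a := by
  induction i using backward_induction (j := j) generalizing ω with
  | base i hi => rw [c.ex_of_le hi]
  | step i hi ih => simp only [c.ex_step hi, ih, ← Finset.sum_mul, c.P_sum, one_mul]

lemma ex_add (i j : ℕ) (ω : ℕ → V) (F G : (ℕ → V) → ℝ) :
    c.ex i j ω (fun ω' => F ω' + G ω') = c.ex i j ω F + c.ex i j ω G := by
  induction i using backward_induction (j := j) generalizing ω with
  | base i hi => simp only [c.ex_of_le hi]
  | step i hi ih => simp only [c.ex_step hi, ih, mul_add, Finset.sum_add_distrib]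

lemma ex_const_mul (i j : ℕ) (ω : ℕ → V) (a : ℝ) (F : (ℕ → V) → ℝ) :
    c.ex i j ω (fun ω' => a * F ω') = a * c.ex i j ω F := by
  induction i using backward_induction (j := j) generalizing ω with
  | base i hi => simp only [c.ex_of_le hi]
  | step i hi ih =>
    simp only [c.ex_step hi, ih, Finset.mul_sum]
    exact Finset.sum_congr rfl fun w _ => by ring

lemma ex_sub (i j : ℕ) (ω : ℕ → V) (F G : (ℕ → V) → ℝ) :
    c.ex i j ω (fun ω' => F ω' - G ω') = c.ex i j ω F - c.ex i j ω G := by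
  have h := c.ex_add i j ω F (fun ω' => (-1) * G ω')
  rw [c.ex_const_mul] at h
  rw [sub_eq_add_neg, ← neg_one_mul, ← h]
  exact c.ex_congr fun ω' _ => by ring

lemma ex_sum {ι : Type} (s : Finset ι) (i j : ℕ) (ω : ℕ → V) (F : ι → (ℕ → V) → ℝ) :
    c.ex i j ω (fun ω' => ∑ a ∈ s, F a ω') = ∑ a ∈ s, c.ex i j ω (F a) := by
  classical
  induction s using Finset.induction_on with
  | empty => simpa using c.ex_const i j ω 0
  | insert a s ha ih => simp only [Finset.sum_insert ha, c.ex_add, ih]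

lemma ex_nonneg {i j : ℕ} {ω : ℕ → V} {F : (ℕ → V) → ℝ} (h : ∀ ω', 0 ≤ F ω') :
    0 ≤ c.ex i j ω F := by
  rw [← c.ex_const i j ω 0]
  exact c.ex_mono fun ω' _ => h ω'

lemma abs_ex_le {i j : ℕ} {ω : ℕ → V} {F : (ℕ → V) → ℝ} {b : ℝ}
    (h : ∀ ω', (∀ s ≤ i, ω' s = ω s) → |F ω'| ≤ b) : |c.ex i j ω F| ≤ b := by
  rw [abs_le]
  constructor
  · rw [← c.ex_const i j ω (-b)]
    exact c.ex_mono fun ω' hω' => (abs_le.1 (h ω' hω')).1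
  · rw [← c.ex_const i j ω b]
    exact c.ex_mono fun ω' hω' => (abs_le.1 (h ω' hω')).2

/-- The tower property. -/
lemma ex_tower {i m j : ℕ} (him : i ≤ m) (hmj : m ≤ j) (ω : ℕ → V) (F : (ℕ → V) → ℝ) :
    c.ex i j ω F = c.ex i m ω (fun ω' => c.ex m j ω' F) := by
  induction i using backward_induction (j := m) generalizing ω with
  | base i hi => rw [c.ex_of_le hi, le_antisymm him hi]
  | step i hi ih =>
    rw [c.ex_step (hi.trans_le hmj), c.ex_step hi]
    simp only [ih hi]

lemma ex_of_dependsOn {i m j : ℕ} (him : i ≤ m) (hmj : m ≤ j) {F : (ℕ → V) → ℝ}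
    (hF : DependsOn F (Set.Iic m)) (ω : ℕ → V) : c.ex i j ω F = c.ex i m ω F := by
  rw [c.ex_tower him hmj]
  refine c.ex_congr fun ω' _ => ?_
  rw [← c.ex_const m j ω' (F ω')]
  exact c.ex_congr fun ω'' h'' => hF h''

lemma ex_eval {i j : ℕ} (hij : i ≤ j) (ω : ℕ → V) (f : V → ℝ) :
    c.ex i j ω (fun ω' => f (ω' j)) = (c.P ^ (j - i) *ᵥ f) (ω i) := by
  induction i using backward_induction (j := j) generalizing ω with
  | base i hi => rw [c.ex_of_le hi, le_antisymm hij hi]; simp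
  | step i hi ih =>
    rw [c.ex_step hi, show j - i = (j - (i + 1)) + 1 by omega, pow_succ', ← mulVec_mulVec]
    simp only [ih hi, Function.update_self]
    rfl

/-- The law of a trajectory is invariant under time shifts. -/
lemma ex_shift (a i j : ℕ) (ω : ℕ → V) (G : (ℕ → V) → ℝ) :
    c.ex (a + i) (a + j) ω (fun ω' => G fun s => ω' (a + s)) =
      c.ex i j (fun s => ω (a + s)) G := by
  induction i using backward_induction (j := j) generalizing ω with
  | base i hi => rw [c.ex_of_le hi, c.ex_of_le (by omega)]
  | step i hi ih =>
    rw [c.ex_step hi, c.ex_step (by omega)]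
    refine Finset.sum_congr rfl fun w _ => ?_
    rw [add_assoc, ih]
    congr 2
    funext s
    by_cases hs : s = i + 1
    · subst hs; simp
    · rw [Function.update_of_ne hs, Function.update_of_ne (by omega)]

lemma dependsOn_ex {i j : ℕ} (hij : i ≤ j) {F : (ℕ → V) → ℝ} (hF : DependsOn F (Set.Iic j)) :
    DependsOn (fun ω => c.ex i j ω F) (Set.Iic i) := by
  induction i using backward_induction (j := j) with
  | base i hi =>
    simp only [c.ex_of_le hi]
    exact hF.mono (Set.Iic_subset_Iic.2 hi)
  | step i hi ih =>
    intro ω₁ ω₂ h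
    simp only [c.ex_step hi, h i (Set.mem_Iic.2 le_rfl)]
    refine Finset.sum_congr rfl fun w _ => ?_
    congr 1
    refine ih hi fun s hs => ?_
    by_cases hs' : s = i + 1
    · subst hs'; simp
    · rw [Function.update_of_ne hs', Function.update_of_ne hs']
      exact h s (Set.mem_Iic.2 (by have := Set.mem_Iic.1 hs; omega))

open Classical in
/-- Probability of an event over trajectories from `ω 0` that take `j` steps. -/
def pr (j : ℕ) (ω : ℕ → V) (E : (ℕ → V) → Prop) : ℝ := c.ex 0 j ω fun ω' => if E ω' then 1 else 0

lemma pr_mono {j : ℕ} {ω : ℕ → V} {E E' : (ℕ → V) → Prop} (h : ∀ ω', E ω' → E' ω') :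
    c.pr j ω E ≤ c.pr j ω E' := by
  refine c.ex_mono fun ω' _ => ?_
  have := h ω'
  by_cases h1 : E ω' <;> by_cases h2 : E' ω' <;> simp_all

lemma pr_or_le (j : ℕ) (ω : ℕ → V) (E E' : (ℕ → V) → Prop) :
    c.pr j ω (fun ω' => E ω' ∨ E' ω') ≤ c.pr j ω E + c.pr j ω E' := by
  rw [pr, pr, pr, ← c.ex_add]
  refine c.ex_mono fun ω' _ => ?_
  by_cases h : E ω' <;> by_cases h' : E' ω' <;> simp [h, h']

lemma pr_false (j : ℕ) (ω : ℕ → V) : c.pr j ω (fun _ => False) = 0 := by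
  simp [pr, c.ex_const]

lemma pr_of_dependsOn {m j : ℕ} (hmj : m ≤ j) {E : (ℕ → V) → Prop}
    (hE : DependsOn E (Set.Iic m)) (ω : ℕ → V) : c.pr j ω E = c.pr m ω E :=
  c.ex_of_dependsOn (Nat.zero_le m) hmj (fun ω₁ ω₂ h => by
    classical
    have h' : E ω₁ = E ω₂ := hE h
    exact if_congr (iff_of_eq h') rfl rfl) ω

/-- Markov's inequality. -/
lemma mul_pr_le {j : ℕ} {ω : ℕ → V} {E : (ℕ → V) → Prop} {F : (ℕ → V) → ℝ} {a : ℝ}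
    (hF : ∀ ω', 0 ≤ F ω') (h : ∀ ω', E ω' → a ≤ F ω') : a * c.pr j ω E ≤ c.ex 0 j ω F := by
  rw [pr, ← c.ex_const_mul]
  refine c.ex_mono fun ω' _ => ?_
  split_ifs with hE
  · simpa using h ω' hE
  · simpa using hF ω'

end ReversibleChain

/-! ### Statistics of a trajectory -/

section Trajectory

variable {V : Type} [DecidableEq V]

/-- The set of states visited by `ω` up to time `m`. -/
def vis (ω : ℕ → V) (m : ℕ) : Finset V := (Finset.range (m + 1)).image ω

/-- The number of samples `i < j` that fall into the set of states visited up to time `i t`, where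
sample `i` is taken at time `(i + ℓ + 1) t`. -/
def hits (t ℓ : ℕ) (ω : ℕ → V) (j : ℕ) : ℕ :=
  ((Finset.range j).filter fun i => ω ((i + ℓ + 1) * t) ∈ vis ω (i * t)).card

lemma mem_vis {ω : ℕ → V} {m : ℕ} {x : V} : x ∈ vis ω m ↔ ∃ s ≤ m, ω s = x := by
  simp [vis]

lemma self_mem_vis (ω : ℕ → V) (m : ℕ) : ω m ∈ vis ω m := mem_vis.2 ⟨m, le_rfl, rfl⟩

lemma vis_mono (ω : ℕ → V) : Monotone (vis ω) := fun _ _ h =>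
  Finset.image_subset_image (Finset.range_mono (by omega))

lemma vis_zero (ω : ℕ → V) : vis ω 0 = {ω 0} := by simp [vis]

lemma vis_succ (ω : ℕ → V) (m : ℕ) : vis ω (m + 1) = insert (ω (m + 1)) (vis ω m) := by
  rw [vis, Finset.range_add_one, Finset.image_insert, ← vis]

lemma vis_congr {ω ω' : ℕ → V} {m : ℕ} (h : ∀ s ≤ m, ω' s = ω s) : vis ω' m = vis ω m :=
  Finset.image_congr fun s hs => h s (by simpa [Nat.lt_succ_iff] using hs)

lemma vis_update (ω : ℕ → V) (i : ℕ) (w : V) :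
    vis (Function.update ω (i + 1) w) (i + 1) = insert w (vis ω i) := by
  rw [vis_succ, Function.update_self, vis_congr (ω := ω)]
  intro s hs
  rw [Function.update_of_ne (by omega)]

lemma card_vis_add_le (ω : ℕ → V) (m s : ℕ) : (vis ω (m + s)).card ≤ (vis ω m).card + s := by
  induction s with
  | zero => simp
  | succ s ih =>
    rw [← add_assoc, vis_succ]
    exact (Finset.card_insert_le _ _).trans (by omega)

lemma card_vis_add_le_add (ω : ℕ → V) (m s : ℕ) :
    (vis ω (m + s)).card ≤ (vis ω m).card + (vis (fun i => ω (m + i)) s).card := by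
  refine (Finset.card_le_card ?_).trans (Finset.card_union_le _ _)
  intro x hx
  obtain ⟨i, hi, rfl⟩ := mem_vis.1 hx
  rw [Finset.mem_union, mem_vis, mem_vis]
  obtain h | h := le_total i m
  · exact Or.inl ⟨i, h, rfl⟩
  · exact Or.inr ⟨i - m, by omega, by rw [show m + (i - m) = i by omega]⟩

lemma hits_zero (t ℓ : ℕ) (ω : ℕ → V) : hits t ℓ ω 0 = 0 := by simp [hits]

lemma hits_succ (t ℓ : ℕ) (ω : ℕ → V) (j : ℕ) :
    hits t ℓ ω (j + 1) =
      hits t ℓ ω j + if ω ((j + ℓ + 1) * t) ∈ vis ω (j * t) then 1 else 0 := by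
  rw [hits, hits, Finset.range_add_one, Finset.filter_insert]
  split_ifs with h
  · rw [Finset.card_insert_of_notMem (by simp)]
  · rfl

lemma hits_mono (t ℓ : ℕ) (ω : ℕ → V) : Monotone (hits t ℓ ω) := fun _ _ h =>
  Finset.card_le_card (Finset.filter_subset_filter _ (Finset.range_mono h))

/-- After `m` passes exactly the samples with numbers below `m - ℓ` have been taken, none while `m ≤
ℓ`. -/
lemma hits_congr {t ℓ m : ℕ} {ω ω' : ℕ → V} (h : ∀ s ≤ m * t, ω' s = ω s) :
    hits t ℓ ω' (m - ℓ) = hits t ℓ ω (m - ℓ) := by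
  rw [hits, hits]
  congr 1
  refine Finset.filter_congr fun i hi => ?_
  have hi := Finset.mem_range.1 hi
  rw [h _ (Nat.mul_le_mul_right t (by omega)),
    vis_congr fun s hs => h s (hs.trans (Nat.mul_le_mul_right t (by omega)))]

/-- Of the samples with numbers divisible by `ℓ + 1`, all but `|V| - 1` are hits. -/
lemma succ_le_hits_add_card [Fintype V] (t ℓ : ℕ) (ω : ℕ → V) (a : ℕ) :
    a + 1 ≤ hits t ℓ ω ((ℓ + 1) * a) + (vis ω ((ℓ + 1) * a * t)).card := by
  induction a with
  | zero => simp [vis_zero]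
  | succ a ih =>
    have h1 : hits t ℓ ω ((ℓ + 1) * a + 1) ≤ hits t ℓ ω ((ℓ + 1) * (a + 1)) :=
      hits_mono t ℓ ω (by rw [mul_add]; omega)
    rw [hits_succ, show (ℓ + 1) * a + ℓ + 1 = (ℓ + 1) * (a + 1) by ring] at h1
    have hsub : vis ω ((ℓ + 1) * a * t) ⊆ vis ω ((ℓ + 1) * (a + 1) * t) :=
      vis_mono ω (Nat.mul_le_mul_right t (Nat.mul_le_mul_left _ (by omega)))
    split_ifs at h1 with h
    · have := Finset.card_le_card hsub
      omega
    -- Sample `(ℓ + 1) a` is taken at time `(ℓ + 1) (a + 1) t`. If it misses the set of time `(ℓ +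
    -- 1) a t`, it exhibits a new state in the set of its own time.
    · have := Finset.card_lt_card ((Finset.ssubset_iff_of_subset hsub).2
        ⟨_, self_mem_vis ω _, h⟩)
      omega

/-- A deterministic horizon: the fuel never runs out before `k` hits, and tail bounds are needed at
one fixed time only. -/
lemma le_hits [Fintype V] (t ℓ k : ℕ) (ω : ℕ → V) :
    k ≤ hits t ℓ ω ((ℓ + 1) * (Fintype.card V + k - 1)) := by
  have h := succ_le_hits_add_card t ℓ ω (Fintype.card V + k - 1)
  have h' := Finset.card_le_univ (vis ω ((ℓ + 1) * (Fintype.card V + k - 1) * t))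
  have : 0 < Fintype.card V := Fintype.card_pos_iff.2 ⟨ω 0⟩
  omega

end Trajectory

/-! ### Stationary mass of the visited sets -/

namespace ReversibleChain

variable {V : Type} [Fintype V] [DecidableEq V] (c : ReversibleChain V)

/-- The stationary mass of a set of states. -/
def setMass (S : Finset V) : ℝ := ∑ x ∈ S, c.π x

lemma setMass_nonneg (S : Finset V) : 0 ≤ c.setMass S := Finset.sum_nonneg fun x _ => c.π_nonneg x

lemma setMass_mono {S S' : Finset V} (h : S ⊆ S') : c.setMass S ≤ c.setMass S' :=
  Finset.sum_le_sum_of_subset_of_nonneg h fun x _ _ => c.π_nonneg x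

lemma setMass_le_one (S : Finset V) : c.setMass S ≤ 1 := by
  rw [← c.π_sum]
  exact c.setMass_mono (Finset.subset_univ S)

/-- The accumulated stationary mass of the sets against which the first `j` samples are tested. -/
def mass (t : ℕ) (ω : ℕ → V) (j : ℕ) : ℝ := ∑ i ∈ Finset.range j, c.setMass (vis ω (i * t))

lemma mass_zero (t : ℕ) (ω : ℕ → V) : c.mass t ω 0 = 0 := by simp [mass]

lemma mass_succ (t : ℕ) (ω : ℕ → V) (j : ℕ) :
    c.mass t ω (j + 1) = c.mass t ω j + c.setMass (vis ω (j * t)) := Finset.sum_range_succ _ _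

lemma mass_mono (t : ℕ) (ω : ℕ → V) : Monotone (c.mass t ω) := fun _ _ h =>
  Finset.sum_le_sum_of_subset_of_nonneg (Finset.range_mono h) fun _ _ _ => c.setMass_nonneg _

lemma mass_congr {t m j : ℕ} {ω ω' : ℕ → V} (hj : j ≤ m + 1) (h : ∀ s ≤ m * t, ω' s = ω s) :
    c.mass t ω' j = c.mass t ω j := by
  refine Finset.sum_congr rfl fun i hi => ?_
  have hi := Finset.mem_range.1 hi
  rw [vis_congr fun s hs => h s (hs.trans (Nat.mul_le_mul_right t (by omega)))]

/-! ### From algorithms to trajectories -/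

lemma expect_walk (g : ℝ → Finset V → ℝ) (T i : ℕ) (ω : ℕ → V) :
    (QueryAlg.walk T (ω i)).expect c g (vis ω i) =
      c.ex i (i + T) ω (fun ω' => g 0 (vis ω' (i + T))) := by
  induction T generalizing i ω with
  | zero => rw [c.ex_of_le (by omega)]; rfl
  | succ T ih =>
    rw [QueryAlg.walk, QueryAlg.expect, c.ex_step (by omega)]
    refine Finset.sum_congr rfl fun w _ => ?_
    have h := ih (i + 1) (Function.update ω (i + 1) w)
    rw [Function.update_self, vis_update] at h
    rw [h, show i + 1 + T = i + (T + 1) by ring]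

/-- The dictionary of mass ratios after the visit of `vis ω m`. -/
def dict (v : V) (ω : ℕ → V) (m : ℕ) : V → Option ℝ :=
  fun x => if x ∈ vis ω m then some (c.π x / c.π v) else none

lemma getD_dict {v x : V} {ω : ℕ → V} {m : ℕ} (h : x ∈ vis ω m) :
    (c.dict v ω m x).getD 0 = c.π x / c.π v := by
  simp [dict, h]

lemma dict_congr {v : V} {ω ω' : ℕ → V} {m m' : ℕ} (h : vis ω m = vis ω' m') :
    c.dict v ω m = c.dict v ω' m' := by
  funext x
  simp only [dict, h]

/-- Detailed balance turns the ratio of the two probed probabilities into `π w / π u`, so the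
dictionary stays equal to `dict`, a function of the trajectory alone. -/
lemma expect_inner (g : ℝ → Finset V → ℝ) (v : V) (t i : ℕ) (ω : ℕ → V) (S₀ : Finset V)
    (hS : S₀ ⊆ vis ω i) (cont : V → (V → Option ℝ) → Finset V → QueryAlg V) :
    (FullMassApprox.inner t (ω i) (c.dict v ω i) (vis ω i \ S₀) cont).expect c g (vis ω i) =
      c.ex i (i + t) ω (fun ω' => (cont (ω' (i + t)) (c.dict v ω' (i + t))
        (vis ω' (i + t) \ S₀)).expect c g (vis ω' (i + t))) := by
  induction t generalizing i ω with
  | zero => rw [c.ex_of_le (by omega)]; rfl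
  | succ t ih =>
    rw [FullMassApprox.inner, QueryAlg.expect, c.ex_step (by omega)]
    refine Finset.sum_congr rfl fun w _ => ?_
    -- Impossible transitions contribute nothing. For possible ones detailed balance makes the
    -- reverse probability nonzero, so the division in the update is legitimate.
    obtain hP | hP := (c.P_nonneg (ω i) w).eq_or_lt
    · rw [← hP, zero_mul, zero_mul]
    congr 1
    have hv := vis_update ω i w
    set ω₁ := Function.update ω (i + 1) w with hω₁
    have hw : ω₁ (i + 1) = w := Function.update_self ..
    have h := ih (i + 1) ω₁ (hS.trans (by rw [hv]; exact Finset.subset_insert _ _))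
    rw [show i + 1 + t = i + (t + 1) by ring] at h
    rw [← h, hw]
    by_cases hmem : w ∈ vis ω i
    · rw [Finset.insert_eq_of_mem hmem] at hv ⊢
      rw [if_neg (by simp [dict, hmem]), c.dict_congr hv, hv]
    · rw [if_pos (by simp [dict, hmem])]
      simp only [QueryAlg.expect]
      rw [hv, Finset.insert_sdiff_of_notMem _ (fun h => hmem (hS h))]
      have hD : Function.update (c.dict v ω i) w
          (some ((c.dict v ω i (ω i)).getD 0 * c.P (ω i) w / c.P w (ω i))) =
            c.dict v ω₁ (i + 1) := by
        rw [c.getD_dict (self_mem_vis ω i)]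
        have hr := c.reversible (ω i) w
        have hQ : c.P w (ω i) ≠ 0 := by
          intro h0
          rw [h0, mul_zero] at hr
          exact (mul_pos (c.π_pos _) hP).ne' hr
        have hval : c.π (ω i) / c.π v * c.P (ω i) w / c.P w (ω i) = c.π w / c.π v := by
          have := (c.π_pos v).ne'
          field_simp
          linarith
        rw [hval]
        funext x
        by_cases hx : x = w
        · subst hx
          simp [dict, hv]
        · simp [dict, hv, hx]
      rw [hD]

/-- The outcome of a sampling procedure that makes at most `fuel` further passes of `t` steps after
pass `m`, tests samples with lag `ℓ + 1`, and halts as soon as there are `k` hits. -/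
def outcome (v : V) (k t ℓ : ℕ) (g : ℝ → Finset V → ℝ) : ℕ → ℕ → (ℕ → V) → ℝ
  | 0, m, ω => g 0 (vis ω (m * t))
  | fuel + 1, m, ω =>
    if hits t ℓ ω (m - ℓ) < k then outcome v k t ℓ g fuel (m + 1) ω
    else g (hits t ℓ ω (m - ℓ) / (c.mass t ω (m - ℓ) / c.π v)) (vis ω (m * t))

/-- The loop invariant: after `m` passes all variables are functionals of the trajectory up to time
`m t`, with `r` the hits at lag one and `w` the mass divided by `π v`. -/
lemma expect_outer (g : ℝ → Finset V → ℝ) (v : V) (k t fuel m : ℕ) (ω : ℕ → V) :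
    (FullMassApprox.outer k t fuel (vis ω (m * t)) (c.dict v ω (m * t))
      (c.setMass (vis ω (m * t)) / c.π v) (c.mass t ω m / c.π v) (hits t 0 ω m)
      (ω (m * t))).expect c g (vis ω (m * t)) =
      c.ex (m * t) ((m + fuel) * t) ω (c.outcome v k t 0 g fuel m) := by
  induction fuel generalizing m ω with
  | zero => rw [c.ex_of_le (by simp)]; rfl
  | succ fuel ih =>
    rw [FullMassApprox.outer]
    split_ifs with hk
    · have h := c.expect_inner g v t (m * t) ω (vis ω (m * t)) subset_rfl
      rw [Finset.sdiff_self] at h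
      rw [h, c.ex_tower (i := m * t) (m := m * t + t) (j := (m + (fuel + 1)) * t) (by omega)
        (by nlinarith)]
      refine c.ex_congr fun ω' hω' => ?_
      have hvis : vis ω' (m * t) = vis ω (m * t) := vis_congr hω'
      have hhit : hits t 0 ω' m = hits t 0 ω m := hits_congr (ℓ := 0) hω'
      have hmt : m * t + t = (m + 1) * t := by ring
      have hsub : vis ω' (m * t) ⊆ vis ω' ((m + 1) * t) := vis_mono ω' (by nlinarith)
      rw [hmt]
      have h1 := ih (m + 1) ω'
      rw [show m + 1 + fuel = m + (fuel + 1) by ring] at h1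
      have hW : c.setMass (vis ω' (m * t)) / c.π v +
          ∑ x ∈ vis ω' ((m + 1) * t) \ vis ω' (m * t), (c.dict v ω' ((m + 1) * t) x).getD 0 =
            c.setMass (vis ω' ((m + 1) * t)) / c.π v := by
        rw [Finset.sum_congr rfl fun x hx => c.getD_dict (Finset.sdiff_subset hx),
          ← Finset.sum_div, ← add_div, setMass, setMass, add_comm, Finset.sum_sdiff hsub]
      have hM : c.mass t ω m / c.π v + c.setMass (vis ω' (m * t)) / c.π v =
          c.mass t ω' (m + 1) / c.π v := by
        rw [c.mass_succ, c.mass_congr (Nat.le_succ m) hω', add_div]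
      have hR : (if ω' ((m + 1) * t) ∈ vis ω' (m * t) then hits t 0 ω m + 1 else hits t 0 ω m) =
          hits t 0 ω' (m + 1) := by
        rw [hits_succ, hhit, add_zero]
        split_ifs <;> rfl
      rw [← hvis, hW, hM, hR, Finset.union_sdiff_of_subset hsub, h1]
      refine c.ex_congr fun ω'' hω'' => ?_
      have : hits t 0 ω'' m = hits t 0 ω' m :=
        hits_congr (ℓ := 0) fun s hs => hω'' s (by nlinarith)
      rw [outcome, if_pos (by rwa [Nat.sub_zero, this, hhit])]
    · rw [QueryAlg.expect]
      refine (c.ex_const (m * t) ((m + (fuel + 1)) * t) ω _).symm.trans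
        (c.ex_congr fun ω' hω' => ?_)
      have hhit : hits t 0 ω' m = hits t 0 ω m := hits_congr (ℓ := 0) hω'
      rw [outcome, Nat.sub_zero, hhit, if_neg hk, c.mass_congr (Nat.le_succ m) hω', vis_congr hω']

/-- The outcome is determined by the first number of samples with `k` hits. -/
lemma outcome_eq_one {v : V} {k t ℓ q : ℕ} (hk : 0 < k) {g : ℝ → Finset V → ℝ} {ω : ℕ → V}
    (hq : k ≤ hits t ℓ ω q)
    (hg : ∀ j ≤ q, hits t ℓ ω j = k → g (k / (c.mass t ω j / c.π v)) (vis ω ((j + ℓ) * t)) = 1) :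
    c.outcome v k t ℓ g (q + ℓ + 1) 0 ω = 1 := by
  suffices H : ∀ fuel m, fuel + m = q + ℓ + 1 → (∀ j < m - ℓ, hits t ℓ ω j < k) →
      c.outcome v k t ℓ g fuel m ω = 1 from H _ 0 rfl (by simp)
  intro fuel
  induction fuel with
  | zero =>
    intro m hm hlt
    exact absurd (hlt q (by omega)) (by omega)
  | succ fuel ih =>
    intro m hm hlt
    rw [outcome]
    split_ifs with h
    · refine ih (m + 1) (by omega) fun j hj => ?_
      obtain h' | h' : j < m - ℓ ∨ j = m - ℓ := by omega
      · exact hlt j h'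
      · rwa [h']
    · have hpos : m - ℓ ≠ 0 := by
        intro h0
        rw [h0, hits_zero] at h
        exact h hk
      -- Each sample adds at most one hit, so the count equals `k` when the threshold is first
      -- reached.
      have hkm : hits t ℓ ω (m - ℓ) = k := by
        have h1 := hlt (m - ℓ - 1) (by omega)
        have h2 := hits_succ t ℓ ω (m - ℓ - 1)
        rw [show m - ℓ - 1 + 1 = m - ℓ by omega] at h2
        split_ifs at h2 <;> omega
      have := hg (m - ℓ) (by omega) hkm
      rwa [show m - ℓ + ℓ = m by omega, ← hkm] at this

/-- Visits of the random walk, in terms of trajectories. -/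
lemma expectedVisits_eq (v : V) (T : ℕ) :
    expectedVisits c v T = c.ex 0 T (fun _ => v) (fun ω => ((vis ω T).card : ℝ)) := by
  have h := c.expect_walk (fun _ S => (S.card : ℝ)) T 0 (fun _ => v)
  rwa [vis_zero, zero_add] at h

lemma prob_walk (v : V) (T : ℕ) (E : ℝ → Finset V → Prop) :
    (QueryAlg.walk T v).prob c v E = c.pr T (fun _ => v) (fun ω => E 0 (vis ω T)) := by
  have h := c.expect_walk (fun x S => @ite ℝ (E x S) (Classical.propDecidable _) 1 0) T 0
    (fun _ => v)
  rwa [vis_zero, zero_add] at h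

end ReversibleChain

/-! ### The algorithm with lagged samples -/

/-- A variant of the outer loop of FullMassApprox in which the sample taken after pass
`i + ℓ + 1` is tested against the set `S i` of states visited before pass `i + 1`. The arguments
record the number `m` of completed passes, and the visited sets and positions after each pass. -/
def laggedOuter {V : Type} [DecidableEq V] (k t ℓ : ℕ) :
    ℕ → ℕ → (ℕ → Finset V) → (V → Option ℝ) → (ℕ → V) → QueryAlg V
  | 0, _, _, _, _ => .output 0
  | fuel + 1, m, S, D, x =>
    if ((Finset.range (m - ℓ)).filter fun i => x (i + ℓ + 1) ∈ S i).card < k then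
      FullMassApprox.inner t (x m) D ∅ fun u D' N =>
        laggedOuter k t ℓ fuel (m + 1) (Function.update S (m + 1) (S m ∪ N)) D'
          (Function.update x (m + 1) u)
    else
      .output (((Finset.range (m - ℓ)).filter fun i => x (i + ℓ + 1) ∈ S i).card /
        ∑ i ∈ Finset.range (m - ℓ), ∑ y ∈ S i, (D y).getD 0)

namespace ReversibleChain

variable {V : Type} [Fintype V] [DecidableEq V] (c : ReversibleChain V)

/-- The same invariant with the history of sets and positions kept. The latest dictionary serves all
earlier sets, because they are contained in the current one. -/
lemma expect_laggedOuter (g : ℝ → Finset V → ℝ) (v : V) (k t ℓ fuel m : ℕ) (ω : ℕ → V)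
    (S : ℕ → Finset V) (x : ℕ → V) (hS : ∀ i ≤ m, S i = vis ω (i * t))
    (hx : ∀ i ≤ m, x i = ω (i * t)) :
    (laggedOuter k t ℓ fuel m S (c.dict v ω (m * t)) x).expect c g (vis ω (m * t)) =
      c.ex (m * t) ((m + fuel) * t) ω (c.outcome v k t ℓ g fuel m) := by
  induction fuel generalizing m ω S x with
  | zero => rw [c.ex_of_le (by simp)]; rfl
  | succ fuel ih =>
    have hcard : ((Finset.range (m - ℓ)).filter fun i => x (i + ℓ + 1) ∈ S i).card =
        hits t ℓ ω (m - ℓ) := by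
      rw [hits]
      congr 1
      refine Finset.filter_congr fun i hi => ?_
      have hi := Finset.mem_range.1 hi
      rw [hS i (by omega), hx _ (by omega)]
    rw [laggedOuter, hcard]
    split_ifs with hk
    · have h := c.expect_inner g v t (m * t) ω (vis ω (m * t)) subset_rfl
      rw [Finset.sdiff_self] at h
      rw [hx m le_rfl, h, c.ex_tower (i := m * t) (m := m * t + t) (j := (m + (fuel + 1)) * t)
        (by omega) (by nlinarith)]
      refine c.ex_congr fun ω' hω' => ?_
      have hvis : vis ω' (m * t) = vis ω (m * t) := vis_congr hω'
      have hmt : m * t + t = (m + 1) * t := by ring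
      have hsub : vis ω' (m * t) ⊆ vis ω' ((m + 1) * t) := vis_mono ω' (by nlinarith)
      rw [hmt, ih (m + 1) ω']
      · rw [show m + 1 + fuel = m + (fuel + 1) by ring]
        refine c.ex_congr fun ω'' hω'' => ?_
        have : hits t ℓ ω'' (m - ℓ) = hits t ℓ ω' (m - ℓ) :=
          hits_congr fun s hs => hω'' s (by nlinarith)
        rw [outcome, if_pos (by rwa [this, hits_congr hω'])]
      · intro i hi
        by_cases him : i = m + 1
        · subst him
          rw [Function.update_self, hS m le_rfl, ← hvis, Finset.union_sdiff_of_subset hsub]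
        · rw [Function.update_of_ne him, hS i (by omega)]
          exact (vis_congr fun s hs =>
            hω' s (hs.trans (Nat.mul_le_mul_right t (by omega)))).symm
      · intro i hi
        by_cases him : i = m + 1
        · subst him
          rw [Function.update_self]
        · rw [Function.update_of_ne him, hx i (by omega)]
          exact (hω' _ (Nat.mul_le_mul_right t (by omega))).symm
    · rw [QueryAlg.expect]
      refine Eq.trans ?_ ((c.ex_const (m * t) ((m + (fuel + 1)) * t) ω _).symm.trans
        (c.ex_congr (F := fun _ => g (hits t ℓ ω (m - ℓ) / (c.mass t ω (m - ℓ) / c.π v))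
          (vis ω (m * t))) fun ω' hω' => ?_))
      · congr 2
        rw [mass, Finset.sum_div]
        refine Finset.sum_congr rfl fun i hi => ?_
        have hi := Finset.mem_range.1 hi
        rw [hS i (by omega), setMass, Finset.sum_div]
        exact Finset.sum_congr rfl fun y hy => c.getD_dict
          (vis_mono ω (Nat.mul_le_mul_right t (by omega)) hy)
      · rw [outcome, hits_congr hω', if_neg hk, c.mass_congr (by omega) hω', vis_congr hω']

end ReversibleChain

/-! ### Locality -/

/-- The invariant is that the dictionary is defined on visited states only, so a successful lookup
does not enlarge the visited set. -/
lemma isLocal_inner {V : Type} [DecidableEq V] (t : ℕ) (u : V) (D : V → Option ℝ)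
    (S₀ N : Finset V) (cont : V → (V → Option ℝ) → Finset V → QueryAlg V)
    (hu : u ∈ S₀ ∪ N) (hD : ∀ x, D x ≠ none → x ∈ S₀ ∪ N)
    (hcont : ∀ u D N, u ∈ S₀ ∪ N → (∀ x, D x ≠ none → x ∈ S₀ ∪ N) →
      (cont u D N).IsLocal (S₀ ∪ N)) :
    (FullMassApprox.inner t u D N cont).IsLocal (S₀ ∪ N) := by
  induction t generalizing u D N with
  | zero => exact hcont u D N hu hD
  | succ t ih =>
    rw [FullMassApprox.inner, QueryAlg.IsLocal]
    refine ⟨hu, fun w => ?_⟩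
    split_ifs with hw
    · simp only [QueryAlg.IsLocal]
      have hm : ∀ y ∈ S₀ ∪ N, y ∈ insert w (S₀ ∪ N) := fun y hy => Finset.mem_insert_of_mem hy
      refine ⟨hm u hu, Finset.mem_insert_self _ _, fun p => ⟨Finset.mem_insert_self _ _, hm u hu,
        fun q => ?_⟩⟩
      rw [← Finset.union_insert]
      refine ih _ _ _ (by simp) fun x hx => ?_
      by_cases hxw : x = w
      · simp [hxw]
      · rw [Function.update_of_ne hxw] at hx
        rw [Finset.union_insert]
        exact hm x (hD x hx)
    · rw [Finset.insert_eq_of_mem (hD w hw)]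
      exact ih _ _ _ (hD w hw) hD

lemma isLocal_outer {V : Type} [DecidableEq V] (k t fuel : ℕ) (S : Finset V)
    (D : V → Option ℝ) (wS w : ℝ) (r : ℕ) (u : V) (hu : u ∈ S) (hD : ∀ x, D x ≠ none → x ∈ S) :
    (FullMassApprox.outer k t fuel S D wS w r u).IsLocal S := by
  induction fuel generalizing S D wS w r u with
  | zero => trivial
  | succ fuel ih =>
    rw [FullMassApprox.outer]
    split_ifs
    · have h := isLocal_inner t u D S ∅ (fun u' D' N =>
        FullMassApprox.outer k t fuel (S ∪ N) D' (wS + ∑ x ∈ N, (D' x).getD 0) (w + wS)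
          (if u' ∈ S then r + 1 else r) u') (by simpa using hu) (by simpa using hD)
        (fun u' D' N hu' hD' => ih _ _ _ _ _ _ hu' hD')
      simpa using h
    · trivial

lemma isLocal_laggedOuter {V : Type} [DecidableEq V] (k t ℓ fuel m : ℕ) (S : ℕ → Finset V)
    (D : V → Option ℝ) (x : ℕ → V) (hx : x m ∈ S m) (hD : ∀ y, D y ≠ none → y ∈ S m) :
    (laggedOuter k t ℓ fuel m S D x).IsLocal (S m) := by
  induction fuel generalizing m S D x with
  | zero => trivial
  | succ fuel ih =>
    rw [laggedOuter]
    split_ifs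
    · have h := isLocal_inner t (x m) D (S m) ∅ (fun u D' N =>
        laggedOuter k t ℓ fuel (m + 1) (Function.update S (m + 1) (S m ∪ N)) D'
          (Function.update x (m + 1) u)) (by simpa using hx) (by simpa using hD)
        (fun u' D' N hu' hD' => by
          have h := ih (m + 1) (Function.update S (m + 1) (S m ∪ N)) D'
            (Function.update x (m + 1) u')
          simp only [Function.update_self] at h
          exact h hu' hD')
      simpa using h
    · trivial

/-! ### Samples tested against predictable sets: exponential moments -/

/-- The indicator function of a finite set. -/
def ind {V : Type} [DecidableEq V] (S : Finset V) (x : V) : ℝ := if x ∈ S then 1 else 0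

lemma ind_nonneg {V : Type} [DecidableEq V] (S : Finset V) (x : V) : 0 ≤ ind S x := by
  unfold ind; split_ifs <;> norm_num

lemma ind_le_one {V : Type} [DecidableEq V] (S : Finset V) (x : V) : ind S x ≤ 1 := by
  unfold ind; split_ifs <;> norm_num

lemma ind_osc {V : Type} [DecidableEq V] (S : Finset V) (x y : V) : ind S x - ind S y ≤ 1 := by
  linarith [ind_nonneg S y, ind_le_one S x]

/-- The number of samples `i < q`, taken at time `(i + ℓ + 1) t`, that fall into `B i`. -/
def hitsIn {V : Type} [DecidableEq V] (t ℓ : ℕ) (B : ℕ → (ℕ → V) → Finset V) (ω : ℕ → V) (q : ℕ) :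
    ℕ :=
  ((Finset.range q).filter fun i => ω ((i + ℓ + 1) * t) ∈ B i ω).card

lemma hitsIn_succ {V : Type} [DecidableEq V] (t ℓ : ℕ) (B : ℕ → (ℕ → V) → Finset V) (ω : ℕ → V)
    (q : ℕ) : hitsIn t ℓ B ω (q + 1) =
      hitsIn t ℓ B ω q + if ω ((q + ℓ + 1) * t) ∈ B q ω then 1 else 0 := by
  rw [hitsIn, hitsIn, Finset.range_add_one, Finset.filter_insert]
  split_ifs with h
  · rw [Finset.card_insert_of_notMem (by simp)]
  · rfl

lemma hitsIn_eq_sum {V : Type} [DecidableEq V] (t ℓ : ℕ) (B : ℕ → (ℕ → V) → Finset V) (ω : ℕ → V)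
    (q : ℕ) : (hitsIn t ℓ B ω q : ℝ) =
      ∑ i ∈ Finset.range q, ind (B i ω) (ω ((i + ℓ + 1) * t)) := by
  simp [hitsIn, ind]

namespace ReversibleChain

variable {V : Type} [Fintype V] [DecidableEq V] (c : ReversibleChain V)

/-- The accumulated stationary mass of the sets `B i`, `i < q`. -/
def massIn (B : ℕ → (ℕ → V) → Finset V) (ω : ℕ → V) (q : ℕ) : ℝ :=
  ∑ i ∈ Finset.range q, c.setMass (B i ω)

lemma massIn_succ (B : ℕ → (ℕ → V) → Finset V) (ω : ℕ → V) (q : ℕ) :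
    c.massIn B ω (q + 1) = c.massIn B ω q + c.setMass (B q ω) := Finset.sum_range_succ _ _

lemma π_dotProduct_ind (S : Finset V) : c.π ⬝ᵥ ind S = c.setMass S := by
  simp [dotProduct, ind, setMass]

/-- Exponential moments of the number of samples that fall into predictable sets. -/
lemma ex_pow_hitsIn_le (t : ℕ) {B : ℕ → (ℕ → V) → Finset V}
    (hB : ∀ i, DependsOn (B i) (Set.Iic (i * t))) {a : ℝ} (ha : 0 ≤ a) (q : ℕ) (ω : ℕ → V) :
    c.ex 0 (q * t) ω (fun ω' => a ^ hitsIn t 0 B ω' q * Real.exp (-((a - 1) * c.massIn B ω' q))) ≤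
      Real.exp (q * (|a - 1| * c.mixErr t)) := by
  induction q with
  | zero => rw [c.ex_of_le (by simp)]; simp [hitsIn, massIn]
  | succ q ih =>
    have hqt : (q + 1) * t - q * t = t := by rw [add_mul, one_mul, Nat.add_sub_cancel_left]
    rw [c.ex_tower (Nat.zero_le _) (show q * t ≤ (q + 1) * t by nlinarith)]
    have hstep : ∀ ω', c.ex (q * t) ((q + 1) * t) ω' (fun ω'' => a ^ hitsIn t 0 B ω'' (q + 1) *
        Real.exp (-((a - 1) * c.massIn B ω'' (q + 1)))) ≤ Real.exp (|a - 1| * c.mixErr t) *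
          (a ^ hitsIn t 0 B ω' q * Real.exp (-((a - 1) * c.massIn B ω' q))) := by
      intro ω'
      set S := B q ω' with hS
      have hF : c.ex (q * t) ((q + 1) * t) ω' (fun ω'' => a ^ hitsIn t 0 B ω'' (q + 1) *
          Real.exp (-((a - 1) * c.massIn B ω'' (q + 1)))) =
            a ^ hitsIn t 0 B ω' q * Real.exp (-((a - 1) * c.massIn B ω' q)) *
              Real.exp (-((a - 1) * c.setMass S)) *
              c.ex (q * t) ((q + 1) * t) ω' (fun ω'' =>
                (fun x => 1 + (a - 1) * ind S x) (ω'' ((q + 1) * t))) := by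
        rw [← c.ex_const_mul]
        refine c.ex_congr fun ω'' h => ?_
        have hBe : ∀ i ≤ q, B i ω'' = B i ω' := fun i hi =>
          hB i fun s hs => h s ((Set.mem_Iic.1 hs).trans (Nat.mul_le_mul_right t hi))
        have h1 : hitsIn t 0 B ω'' q = hitsIn t 0 B ω' q := by
          rw [hitsIn, hitsIn]
          congr 1
          refine Finset.filter_congr fun i hi => ?_
          have hi := Finset.mem_range.1 hi
          rw [hBe i hi.le, h _ (Nat.mul_le_mul_right t (by omega))]
        have h2 : c.massIn B ω'' q = c.massIn B ω' q :=
          Finset.sum_congr rfl fun i hi => by rw [hBe i (Finset.mem_range.1 hi).le]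
        rw [hitsIn_succ, c.massIn_succ, h1, h2, hBe q le_rfl, ← hS, add_zero, mul_add, neg_add,
          Real.exp_add, pow_add]
        simp only [ind]
        split_ifs <;> ring
      have hosc : ∀ x y, (1 + (a - 1) * ind S x) - (1 + (a - 1) * ind S y) ≤ |a - 1| := by
        intro x y
        have h1 := le_abs_self (a - 1)
        have h2 := neg_le_abs (a - 1)
        have h3 := abs_nonneg (a - 1)
        unfold ind
        split_ifs <;> linarith
      have h1 := (abs_le.1 (c.abs_pow_mulVec_sub_le_mixErr t hosc (ω' (q * t)))).2
      have hπ : c.π ⬝ᵥ (fun x => 1 + (a - 1) * ind S x) = 1 + (a - 1) * c.setMass S := by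
        rw [← c.π_dotProduct_ind]
        simp only [dotProduct, mul_add, mul_one, Finset.sum_add_distrib, c.π_sum, Finset.mul_sum]
        congr 1
        exact Finset.sum_congr rfl fun x _ => by ring
      rw [hπ] at h1
      -- The supermartingale step: given the past, the new factor has mean `1 + (a - 1) π(S)` up to
      -- the mixing error, and `1 + z ≤ exp z`. The mass term of the exponent cancels the first part
      -- and leaves one error factor per sample.
      have h2 : (c.P ^ t *ᵥ fun x => 1 + (a - 1) * ind S x) (ω' (q * t)) ≤
          Real.exp ((a - 1) * c.setMass S) * Real.exp (|a - 1| * c.mixErr t) := by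
        rw [← Real.exp_add]
        have := Real.add_one_le_exp ((a - 1) * c.setMass S + |a - 1| * c.mixErr t)
        linarith
      rw [hF, c.ex_eval (by nlinarith) ω' (fun x => 1 + (a - 1) * ind S x), hqt]
      have h3 : Real.exp (-((a - 1) * c.setMass S)) * Real.exp ((a - 1) * c.setMass S) = 1 := by
        rw [← Real.exp_add, neg_add_cancel, Real.exp_zero]
      have h4 : 0 ≤ a ^ hitsIn t 0 B ω' q * Real.exp (-((a - 1) * c.massIn B ω' q)) := by positivity
      calc _ ≤ a ^ hitsIn t 0 B ω' q * Real.exp (-((a - 1) * c.massIn B ω' q)) *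
              Real.exp (-((a - 1) * c.setMass S)) *
              (Real.exp ((a - 1) * c.setMass S) * Real.exp (|a - 1| * c.mixErr t)) :=
            mul_le_mul_of_nonneg_left h2 (mul_nonneg h4 (Real.exp_pos _).le)
        _ = Real.exp (|a - 1| * c.mixErr t) *
              (a ^ hitsIn t 0 B ω' q * Real.exp (-((a - 1) * c.massIn B ω' q))) *
              (Real.exp (-((a - 1) * c.setMass S)) * Real.exp ((a - 1) * c.setMass S)) := by ring
        _ = _ := by rw [h3, mul_one]
    refine (c.ex_mono fun ω' _ => hstep ω').trans ?_
    rw [c.ex_const_mul]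
    refine (mul_le_mul_of_nonneg_left ih (Real.exp_pos _).le).trans_eq ?_
    rw [← Real.exp_add]
    push_cast
    ring_nf

/-! ### Second moments -/

/-- The centred indicator of the event that sample `i` falls into `B i`. -/
def dev (t ℓ : ℕ) (B : ℕ → (ℕ → V) → Finset V) (i : ℕ) (ω : ℕ → V) : ℝ :=
  ind (B i ω) (ω ((i + ℓ + 1) * t)) - c.setMass (B i ω)

lemma abs_ind_sub_le (S : Finset V) (x : V) : |ind S x - c.setMass S| ≤ 1 := by
  rw [abs_le]
  constructor <;>
    linarith [ind_nonneg S x, ind_le_one S x, c.setMass_nonneg S, c.setMass_le_one S]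

section SecondMoment

variable {t ℓ L : ℕ} {B : ℕ → (ℕ → V) → Finset V}

lemma dependsOn_dev (hB : ∀ i, DependsOn (B i) (Set.Iic (i * t))) {i m : ℕ}
    (hm : (i + ℓ + 1) * t ≤ m) : DependsOn (c.dev t ℓ B i) (Set.Iic m) := by
  intro ω ω' h
  have hBe : B i ω = B i ω' := hB i fun s hs => h s (Set.mem_Iic.2
    ((Set.mem_Iic.1 hs).trans (le_trans (Nat.mul_le_mul_right t (by omega)) hm)))
  rw [dev, dev, hBe, h _ (Set.mem_Iic.2 hm)]

/-- Given the trajectory up to time `i t` the set is fixed and the sample is nearly stationary; the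
variance of an indicator is at most its mean. -/
lemma ex_dev_sq_le (hB : ∀ i, DependsOn (B i) (Set.Iic (i * t))) (hL : ℓ + 1 = 2 * L)
    (hmix : ∀ s, c.mixErr (s * t) ≤ (1 / 2) ^ s) {i J : ℕ} (hJ : (i + ℓ + 1) * t ≤ J)
    (ω : ℕ → V) :
    c.ex 0 J ω (fun ω' => c.dev t ℓ B i ω' ^ 2) ≤
      c.ex 0 J ω (fun ω' => c.setMass (B i ω')) + (1 / 2) ^ L := by
  have hit : i * t ≤ (i + ℓ + 1) * t := Nat.mul_le_mul_right t (by omega)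
  rw [c.ex_of_dependsOn (Nat.zero_le _) hJ (fun ω₁ ω₂ h => by
      simp only [c.dependsOn_dev hB le_rfl h]),
    c.ex_of_dependsOn (F := fun ω' => c.setMass (B i ω')) (Nat.zero_le _) (hit.trans hJ)
      (fun ω₁ ω₂ h => by simp only [hB i h]), c.ex_tower (Nat.zero_le _) hit,
    ← c.ex_const 0 (i * t) ω ((1 / 2) ^ L), ← c.ex_add]
  refine c.ex_mono fun ω' _ => ?_
  set S := B i ω'
  have h1 : c.ex (i * t) ((i + ℓ + 1) * t) ω' (fun ω'' => c.dev t ℓ B i ω'' ^ 2) =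
      c.ex (i * t) ((i + ℓ + 1) * t) ω'
        (fun ω'' => (fun x => (ind S x - c.setMass S) ^ 2) (ω'' ((i + ℓ + 1) * t))) := by
    refine c.ex_congr fun ω'' h => ?_
    have : B i ω'' = S := hB i fun s hs => h s (Set.mem_Iic.1 hs)
    simp only [dev, this]
  have hosc : ∀ x y, (ind S x - c.setMass S) ^ 2 - (ind S y - c.setMass S) ^ 2 ≤ 1 := by
    intro x y
    have := (sq_le_one_iff_abs_le_one _).2 (c.abs_ind_sub_le S x)
    nlinarith [sq_nonneg (ind S y - c.setMass S)]
  have h2 := (abs_le.1 (c.abs_pow_mulVec_sub_le_mixErr ((i + ℓ + 1) * t - i * t) hosc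
    (ω' (i * t)))).2
  have hπ : c.π ⬝ᵥ (fun x => (ind S x - c.setMass S) ^ 2) ≤ c.setMass S := by
    have : c.π ⬝ᵥ (fun x => (ind S x - c.setMass S) ^ 2) =
        (1 - 2 * c.setMass S) * (c.π ⬝ᵥ ind S) + c.setMass S ^ 2 * ∑ x, c.π x := by
      rw [dotProduct, dotProduct, Finset.mul_sum, Finset.mul_sum, ← Finset.sum_add_distrib]
      refine Finset.sum_congr rfl fun x _ => ?_
      unfold ind
      split_ifs <;> ring
    rw [this, c.π_dotProduct_ind, c.π_sum]
    nlinarith [sq_nonneg (c.setMass S)]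
  have h3 : c.mixErr ((i + ℓ + 1) * t - i * t) ≤ (1 / 2) ^ L := by
    refine (c.mixErr_anti (a := L * t) ?_).trans (hmix L)
    rw [← Nat.sub_mul]
    exact Nat.mul_le_mul_right t (by omega)
  rw [h1, c.ex_eval hit ω' (fun x => (ind S x - c.setMass S) ^ 2)]
  linarith

/-- Since the lag is `2 L`, there is always a stretch of `L` intervals that decorrelates: before
sample `j` if `j - i ≥ L`, and before sample `i`, with both sets already known, if `j - i ≤ L`. -/
lemma ex_dev_mul_dev_le (hB : ∀ i, DependsOn (B i) (Set.Iic (i * t))) (hL : ℓ + 1 = 2 * L)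
    (hmix : ∀ s, c.mixErr (s * t) ≤ (1 / 2) ^ s) {i j J : ℕ} (hij : i < j)
    (hJ : (j + ℓ + 1) * t ≤ J) (ω : ℕ → V) :
    c.ex 0 J ω (fun ω' => c.dev t ℓ B i ω' * c.dev t ℓ B j ω') ≤
      2 * (1 / 2) ^ (j - i) * c.ex 0 J ω (fun ω' => c.setMass (B i ω')) + 2 * (1 / 2) ^ L := by
  have hjt : j * t ≤ (j + ℓ + 1) * t := Nat.mul_le_mul_right t (by omega)
  have hbi : (i + ℓ + 1) * t ≤ (j + ℓ + 1) * t := Nat.mul_le_mul_right t (by omega)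
  rw [c.ex_of_dependsOn (Nat.zero_le _) hJ (fun ω₁ ω₂ h => by
      simp only [c.dependsOn_dev hB le_rfl h, c.dependsOn_dev hB hbi h]),
    c.ex_of_dependsOn (F := fun ω' => c.setMass (B i ω')) (m := j * t) (Nat.zero_le _)
      (hjt.trans hJ)
      (fun ω₁ ω₂ h => by
        have : B i ω₁ = B i ω₂ := hB i fun s hs => h s
          ((Set.mem_Iic.1 hs).trans (Nat.mul_le_mul_right t hij.le))
        simp only [this])]
  have hL0 : (0 : ℝ) < (1 / 2) ^ L := by positivity
  obtain hfar | hnear := le_total L (j - i)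
  -- Far samples. At time `g` both sample `i` and the set `B j` are known, and sample `j` lies at
  -- least `L` intervals ahead.
  · have hm : 0 ≤ c.ex 0 (j * t) ω (fun ω' => c.setMass (B i ω')) :=
      c.ex_nonneg fun _ => c.setMass_nonneg _
    set g := max (i + ℓ + 1) j * t with hg
    have hgb : g ≤ (j + ℓ + 1) * t := Nat.mul_le_mul_right t (by omega)
    rw [c.ex_tower (Nat.zero_le _) hgb]
    refine (le_abs_self _).trans ((c.abs_ex_le (b := (1 / 2) ^ L) fun ω' _ => ?_).trans ?_)
    · set S := B j ω'
      have h1 : c.ex g ((j + ℓ + 1) * t) ω' (fun ω'' => c.dev t ℓ B i ω'' * c.dev t ℓ B j ω'') =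
          c.dev t ℓ B i ω' * (c.ex g ((j + ℓ + 1) * t) ω'
            (fun ω'' => (ind S) (ω'' ((j + ℓ + 1) * t))) - c.setMass S) := by
        rw [← c.ex_const g ((j + ℓ + 1) * t) ω' (c.setMass S), ← c.ex_sub, ← c.ex_const_mul]
        refine c.ex_congr fun ω'' h => ?_
        have h2 : c.dev t ℓ B i ω'' = c.dev t ℓ B i ω' :=
          c.dependsOn_dev hB (m := g) (Nat.mul_le_mul_right t (le_max_left _ _))
            fun s hs => h s (Set.mem_Iic.1 hs)
        have h3 : B j ω'' = S := hB j fun s hs => h s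
          ((Set.mem_Iic.1 hs).trans (Nat.mul_le_mul_right t (le_max_right _ _)))
        have h4 : c.dev t ℓ B j ω'' = ind S (ω'' ((j + ℓ + 1) * t)) - c.setMass S := by
          rw [dev, h3]
        rw [h2, h4]
      have h2 := c.abs_pow_mulVec_sub_le_mixErr ((j + ℓ + 1) * t - g) (ind_osc S) (ω' g)
      rw [mul_one, c.π_dotProduct_ind] at h2
      rw [h1, c.ex_eval hgb, abs_mul]
      have h3 : c.mixErr ((j + ℓ + 1) * t - g) ≤ (1 / 2) ^ L := by
        refine (c.mixErr_anti (a := L * t) ?_).trans (hmix L)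
        rw [hg, ← Nat.sub_mul]
        exact Nat.mul_le_mul_right t (by omega)
      calc _ ≤ 1 * (1 / 2 : ℝ) ^ L := mul_le_mul (c.abs_ind_sub_le _ _) (h2.trans h3)
              (abs_nonneg _) zero_le_one
        _ = _ := one_mul _
    · have : 0 ≤ 2 * (1 / 2 : ℝ) ^ (j - i) *
          c.ex 0 (j * t) ω (fun ω' => c.setMass (B i ω')) := by positivity
      linarith
  -- Near samples. At time `j t` both sets are known and sample `i` is at least `L` intervals ahead.
  -- Given sample `i`, the mean deviation `h` of sample `j` is at most `(1/2)^(j-i)`, and the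
  -- stationary mean of `|ind A - π(A)|` is at most `2 π(A)`.
  · have hjs : j * t ≤ (i + ℓ + 1) * t := Nat.mul_le_mul_right t (by omega)
    rw [c.ex_tower (Nat.zero_le _) hjt, ← c.ex_const_mul,
      ← c.ex_const 0 (j * t) ω (2 * (1 / 2) ^ L), ← c.ex_add]
    refine c.ex_mono fun ω' _ => ?_
    set A := B i ω'
    set S := B j ω'
    set h : V → ℝ := fun x => (c.P ^ ((j + ℓ + 1) * t - (i + ℓ + 1) * t) *ᵥ ind S) x - c.setMass S
    have hh : ∀ x, |h x| ≤ (1 / 2) ^ (j - i) := by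
      intro x
      have h1 := c.abs_pow_mulVec_sub_le_mixErr ((j + ℓ + 1) * t - (i + ℓ + 1) * t)
        (ind_osc S) x
      rw [mul_one, c.π_dotProduct_ind, ← Nat.sub_mul,
        show j + ℓ + 1 - (i + ℓ + 1) = j - i by omega] at h1
      simp only [h]
      rw [← Nat.sub_mul, show j + ℓ + 1 - (i + ℓ + 1) = j - i by omega]
      exact h1.trans (hmix _)
    set f : V → ℝ := fun x => (ind A x - c.setMass A) * h x
    have h1 : c.ex (j * t) ((j + ℓ + 1) * t) ω'
        (fun ω'' => c.dev t ℓ B i ω'' * c.dev t ℓ B j ω'') =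
          c.ex (j * t) ((i + ℓ + 1) * t) ω' (fun ω'' => f (ω'' ((i + ℓ + 1) * t))) := by
      rw [c.ex_tower hjs hbi]
      refine c.ex_congr fun ω₁ hω₁ => ?_
      simp only [f, h]
      rw [← c.ex_eval hbi ω₁ (ind S), ← c.ex_const ((i + ℓ + 1) * t) ((j + ℓ + 1) * t) ω₁
        (c.setMass S), ← c.ex_sub, ← c.ex_const_mul]
      refine c.ex_congr fun ω₂ hω₂ => ?_
      have hag : ∀ s ≤ j * t, ω₂ s = ω' s := fun s hs =>
        (hω₂ s (hs.trans hjs)).trans (hω₁ s hs)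
      have e1 : B i ω₂ = A := hB i fun s hs => hag s
        ((Set.mem_Iic.1 hs).trans (Nat.mul_le_mul_right t hij.le))
      have e2 : B j ω₂ = S := hB j fun s hs => hag s (Set.mem_Iic.1 hs)
      rw [dev, dev, e1, e2, hω₂ _ le_rfl]
    have hf : ∀ x, |f x| ≤ 1 := by
      intro x
      simp only [f]
      rw [abs_mul]
      exact mul_le_one₀ (c.abs_ind_sub_le A x) (abs_nonneg _)
        ((hh x).trans (pow_le_one₀ (by norm_num) (by norm_num)))
    have hosc : ∀ x y, f x - f y ≤ 2 := fun x y => by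
      linarith [(abs_le.1 (hf x)).2, (abs_le.1 (hf y)).1]
    have h2 := (abs_le.1 (c.abs_pow_mulVec_sub_le_mixErr ((i + ℓ + 1) * t - j * t) hosc
      (ω' (j * t)))).2
    have h3 : c.mixErr ((i + ℓ + 1) * t - j * t) ≤ (1 / 2) ^ L := by
      refine (c.mixErr_anti (a := L * t) ?_).trans (hmix L)
      rw [← Nat.sub_mul]
      exact Nat.mul_le_mul_right t (by omega)
    have hπ : c.π ⬝ᵥ f ≤ 2 * (1 / 2) ^ (j - i) * c.setMass A := by
      calc c.π ⬝ᵥ f ≤ ∑ x, (1 / 2) ^ (j - i) * (c.π x * ind A x + c.setMass A * c.π x) := by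
            refine Finset.sum_le_sum fun x _ => ?_
            have e1 : f x ≤ (ind A x + c.setMass A) * (1 / 2) ^ (j - i) := by
              refine (le_abs_self _).trans ?_
              simp only [f]
              rw [abs_mul]
              refine mul_le_mul ?_ (hh x) (abs_nonneg _) ?_
              · rw [abs_le]
                constructor <;> linarith [ind_nonneg A x, c.setMass_nonneg A]
              · linarith [ind_nonneg A x, c.setMass_nonneg A]
            nlinarith [mul_le_mul_of_nonneg_left e1 (c.π_nonneg x)]
        _ = (1 / 2) ^ (j - i) * (c.π ⬝ᵥ ind A + c.setMass A * ∑ x, c.π x) := by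
            rw [← Finset.mul_sum, Finset.sum_add_distrib, ← Finset.mul_sum, dotProduct]
        _ = _ := by rw [c.π_dotProduct_ind, c.π_sum]; ring
    rw [h1, c.ex_eval hjs]
    linarith

/-- The variance of the number of lagged samples that fall into predictable sets. -/
lemma ex_sq_hitsIn_sub_massIn_le (hB : ∀ i, DependsOn (B i) (Set.Iic (i * t)))
    (hL : ℓ + 1 = 2 * L) (hmix : ∀ s, c.mixErr (s * t) ≤ (1 / 2) ^ s) (q : ℕ) (ω : ℕ → V) :
    c.ex 0 ((q + ℓ) * t) ω (fun ω' => ((hitsIn t ℓ B ω' q : ℝ) - c.massIn B ω' q) ^ 2) ≤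
      5 * c.ex 0 ((q + ℓ) * t) ω (fun ω' => c.massIn B ω' q) + 2 * q ^ 2 * (1 / 2) ^ L := by
  set J := (q + ℓ) * t with hJ
  set m : ℕ → ℝ := fun i => c.ex 0 J ω (fun ω' => c.setMass (B i ω')) with hm
  have hm0 : ∀ i, 0 ≤ m i := fun i => c.ex_nonneg fun _ => c.setMass_nonneg _
  -- The coefficients make the induction exact. Passing from `r` to `r + 1` raises the coefficient
  -- of `m i` by `4 (1/2)^(r-i)`, twice the covariance bound, and the new term enters with
  -- coefficient `5 - 8/2 = 1`, the variance bound.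
  have key : ∀ r ≤ q, c.ex 0 J ω (fun ω' => (∑ i ∈ Finset.range r, c.dev t ℓ B i ω') ^ 2) ≤
      ∑ i ∈ Finset.range r, (5 - 8 * (1 / 2) ^ (r - i)) * m i + 2 * r ^ 2 * (1 / 2) ^ L := by
    intro r
    induction r with
    | zero => intro _; simp [c.ex_const]
    | succ r ih =>
      intro hr
      have hrJ : (r + ℓ + 1) * t ≤ J := Nat.mul_le_mul_right t (by omega)
      have e : c.ex 0 J ω (fun ω' => (∑ i ∈ Finset.range (r + 1), c.dev t ℓ B i ω') ^ 2) =
          c.ex 0 J ω (fun ω' => (∑ i ∈ Finset.range r, c.dev t ℓ B i ω') ^ 2) +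
          (2 * ∑ i ∈ Finset.range r, c.ex 0 J ω
            (fun ω' => c.dev t ℓ B i ω' * c.dev t ℓ B r ω') +
          c.ex 0 J ω (fun ω' => c.dev t ℓ B r ω' ^ 2)) := by
        rw [← c.ex_sum, ← c.ex_const_mul, ← c.ex_add, ← c.ex_add]
        refine c.ex_congr fun ω' _ => ?_
        rw [Finset.sum_range_succ, ← Finset.sum_mul]
        ring
      have h1 := ih (by omega)
      have h2 : ∑ i ∈ Finset.range r, c.ex 0 J ω
          (fun ω' => c.dev t ℓ B i ω' * c.dev t ℓ B r ω') ≤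
          ∑ i ∈ Finset.range r, (2 * (1 / 2) ^ (r - i) * m i + 2 * (1 / 2) ^ L) :=
        Finset.sum_le_sum fun i hi =>
          c.ex_dev_mul_dev_le hB hL hmix (Finset.mem_range.1 hi) hrJ ω
      have h3 := c.ex_dev_sq_le hB hL hmix hrJ ω
      rw [Finset.sum_add_distrib, Finset.sum_const, Finset.card_range, nsmul_eq_mul] at h2
      have h4 : ∑ i ∈ Finset.range (r + 1), (5 - 8 * (1 / 2 : ℝ) ^ (r + 1 - i)) * m i =
          ∑ i ∈ Finset.range r, (5 - 8 * (1 / 2) ^ (r - i)) * m i +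
          2 * ∑ i ∈ Finset.range r, 2 * (1 / 2) ^ (r - i) * m i + m r := by
        rw [Finset.sum_range_succ, Finset.mul_sum, ← Finset.sum_add_distrib]
        congr 1
        · refine Finset.sum_congr rfl fun i hi => ?_
          rw [show r + 1 - i = r - i + 1 by have := Finset.mem_range.1 hi; omega, pow_succ]
          ring
        · rw [show r + 1 - r = 1 by omega]
          ring
      have hpos : (0 : ℝ) < (1 / 2) ^ L := by positivity
      rw [e, h4]
      push_cast
      nlinarith
  have hsum : ∀ ω', (hitsIn t ℓ B ω' q : ℝ) - c.massIn B ω' q =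
      ∑ i ∈ Finset.range q, c.dev t ℓ B i ω' := by
    intro ω'
    rw [hitsIn_eq_sum, massIn, ← Finset.sum_sub_distrib]
    rfl
  simp only [hsum]
  refine (key q le_rfl).trans ?_
  have : c.ex 0 J ω (fun ω' => c.massIn B ω' q) = ∑ i ∈ Finset.range q, m i := by
    simp only [massIn]
    rw [c.ex_sum]
  rw [this, Finset.mul_sum]
  refine add_le_add (Finset.sum_le_sum fun i _ => mul_le_mul_of_nonneg_right ?_ (hm0 i)) le_rfl
  have : (0 : ℝ) < (1 / 2) ^ (q - i) := by positivity
  linarith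

end SecondMoment

/-! ### Truncation at a level of the accumulated mass -/

/-- The visited sets, as long as the accumulated mass including them is at most `θ`. -/
def setsBelow (t : ℕ) (θ : ℝ) (i : ℕ) (ω : ℕ → V) : Finset V :=
  if c.mass t ω (i + 1) ≤ θ then vis ω (i * t) else ∅

/-- The visited sets, until the accumulated mass exceeds `θ`. -/
def setsUntil (t : ℕ) (θ : ℝ) (i : ℕ) (ω : ℕ → V) : Finset V :=
  if c.mass t ω i ≤ θ then vis ω (i * t) else ∅

lemma dependsOn_setsBelow (t : ℕ) (θ : ℝ) (i : ℕ) :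
    DependsOn (c.setsBelow t θ i) (Set.Iic (i * t)) := by
  intro ω ω' h
  have h' : ∀ s ≤ i * t, ω s = ω' s := fun s hs => h s hs
  rw [setsBelow, setsBelow, c.mass_congr le_rfl h', vis_congr h']

lemma dependsOn_setsUntil (t : ℕ) (θ : ℝ) (i : ℕ) :
    DependsOn (c.setsUntil t θ i) (Set.Iic (i * t)) := by
  intro ω ω' h
  have h' : ∀ s ≤ i * t, ω s = ω' s := fun s hs => h s hs
  rw [setsUntil, setsUntil, c.mass_congr (Nat.le_succ i) h', vis_congr h']

lemma massIn_setsBelow_le {t : ℕ} {θ : ℝ} (hθ : 0 ≤ θ) (ω : ℕ → V) (q : ℕ) :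
    c.massIn (c.setsBelow t θ) ω q ≤ θ := by
  have hle : ∀ q, c.massIn (c.setsBelow t θ) ω q ≤ c.mass t ω q := fun q => by
    refine Finset.sum_le_sum fun i _ => c.setMass_mono ?_
    rw [setsBelow]
    split_ifs <;> simp
  induction q with
  | zero => simpa [massIn] using hθ
  | succ q ih =>
    by_cases h : c.mass t ω (q + 1) ≤ θ
    · exact (hle _).trans h
    · rw [massIn_succ, setsBelow, if_neg h]
      simpa [setMass] using ih

/-- Turns `k` hits at too small a mass, at a random time, into `k` hits of the truncated sets at a
fixed time, where their mass cannot exceed `θ`. -/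
lemma hits_le_hitsIn_setsBelow {t ℓ q j : ℕ} {θ : ℝ} (hj : j ≤ q) {ω : ℕ → V}
    (h : c.mass t ω j ≤ θ) : hits t ℓ ω j ≤ hitsIn t ℓ (c.setsBelow t θ) ω q := by
  refine Finset.card_le_card fun i hi => ?_
  rw [Finset.mem_filter, Finset.mem_range] at hi ⊢
  refine ⟨by omega, ?_⟩
  rw [setsBelow, if_pos ((c.mass_mono t ω (by omega)).trans h)]
  exact hi.2

/-- The set at which the level is crossed is kept, and it overshoots by at most one. -/
lemma massIn_setsUntil_le {t : ℕ} {θ : ℝ} (hθ : 0 ≤ θ) (ω : ℕ → V) (q : ℕ) :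
    c.massIn (c.setsUntil t θ) ω q ≤ θ + 1 := by
  have hle : ∀ q, c.massIn (c.setsUntil t θ) ω q ≤ c.mass t ω q := fun q => by
    refine Finset.sum_le_sum fun i _ => c.setMass_mono ?_
    rw [setsUntil]
    split_ifs <;> simp
  induction q with
  | zero => simp only [massIn, Finset.range_zero, Finset.sum_empty]; linarith
  | succ q ih =>
    by_cases h : c.mass t ω q ≤ θ
    · rw [massIn_succ]
      exact add_le_add ((hle _).trans h) (c.setMass_le_one _)
    · rw [massIn_succ, setsUntil, if_neg h]
      simpa [setMass] using ih

/-- Nothing is discarded before the level has been crossed. -/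
lemma lt_massIn_setsUntil {t q j : ℕ} {θ : ℝ} (hj : j ≤ q) {ω : ℕ → V}
    (h : θ < c.mass t ω j) : θ < c.massIn (c.setsUntil t θ) ω q := by
  have hmono : c.massIn (c.setsUntil t θ) ω j ≤ c.massIn (c.setsUntil t θ) ω q :=
    Finset.sum_le_sum_of_subset_of_nonneg (Finset.range_mono hj) fun _ _ _ => c.setMass_nonneg _
  refine lt_of_lt_of_le ?_ hmono
  have key : ∀ j, c.massIn (c.setsUntil t θ) ω j = c.mass t ω j ∨
      θ < c.massIn (c.setsUntil t θ) ω j := by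
    intro j
    induction j with
    | zero => exact Or.inl (by simp [massIn, mass])
    | succ j ih =>
      by_cases hθ : c.mass t ω j ≤ θ
      · rw [massIn_succ, setsUntil, if_pos hθ, c.mass_succ]
        rcases ih with ih | ih
        · exact Or.inl (by rw [ih])
        · exact Or.inr (by linarith [c.setMass_nonneg (vis ω (j * t))])
      · right
        rw [massIn_succ]
        rcases ih with ih | ih
        · linarith [c.setMass_nonneg (c.setsUntil t θ j ω)]
        · linarith [c.setMass_nonneg (c.setsUntil t θ j ω)]
  rcases key j with h' | h'
  · rwa [h']
  · exact h'

/-- Samples counted after truncation precede the crossing of `θ`, hence precede `j`. Too large a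
mass at the `k`-th hit thus leaves at most `k` truncated hits. -/
lemma hitsIn_setsUntil_le_hits {t ℓ q j : ℕ} {θ : ℝ} {ω : ℕ → V} (h : θ < c.mass t ω j) :
    hitsIn t ℓ (c.setsUntil t θ) ω q ≤ hits t ℓ ω j := by
  refine Finset.card_le_card fun i hi => ?_
  rw [Finset.mem_filter, Finset.mem_range] at hi ⊢
  by_cases hi' : c.mass t ω i ≤ θ
  · refine ⟨?_, by simpa [setsUntil, hi'] using hi.2⟩
    by_contra! hji
    linarith [c.mass_mono t ω hji]
  · simp [setsUntil, hi'] at hi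

end ReversibleChain

namespace ReversibleChain

variable {V : Type} [Fintype V] [DecidableEq V] (c : ReversibleChain V)

/-! ### Expected numbers of visited states -/

lemma ex_card_vis {v : V} {m j : ℕ} (h : m ≤ j) :
    c.ex 0 j (fun _ => v) (fun ω => ((vis ω m).card : ℝ)) = expectedVisits c v m := by
  rw [expectedVisits_eq]
  exact c.ex_of_dependsOn (Nat.zero_le _) h (fun ω ω' h' => by
    simp only [vis_congr fun s hs => h' s (Set.mem_Iic.2 hs)]) _

lemma expectedVisits_nonneg (v : V) (T : ℕ) : 0 ≤ expectedVisits c v T := by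
  rw [expectedVisits_eq]
  exact c.ex_nonneg fun _ => Nat.cast_nonneg _

lemma expectedVisits_le_card (v : V) (T : ℕ) : expectedVisits c v T ≤ Fintype.card V := by
  rw [expectedVisits_eq, ← c.ex_const 0 T (fun _ => v) (Fintype.card V)]
  exact c.ex_mono fun ω _ => by exact_mod_cast Finset.card_le_univ _

lemma expectedVisits_zero (v : V) : expectedVisits c v 0 = 1 := by
  rw [expectedVisits_eq, c.ex_of_le le_rfl, vis_zero]
  simp

lemma expectedVisits_mono (v : V) : Monotone (expectedVisits c v) := by
  intro T T' h
  rw [← c.ex_card_vis h, ← c.ex_card_vis (le_refl T')]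
  exact c.ex_mono fun ω _ => by exact_mod_cast Finset.card_le_card (vis_mono ω h)

lemma expectedVisits_add_le (v : V) (T s : ℕ) :
    expectedVisits c v (T + s) ≤ expectedVisits c v T + s := by
  rw [← c.ex_card_vis (le_refl (T + s)), ← c.ex_card_vis (Nat.le_add_right T s),
    ← c.ex_const 0 (T + s) (fun _ => v) s, ← c.ex_add]
  exact c.ex_mono fun ω _ => by exact_mod_cast card_vis_add_le ω T s

lemma ex_card_vis_shift (v : V) (T s : ℕ) :
    c.ex 0 (T + s) (fun _ => v) (fun ω => ((vis (fun i => ω (T + i)) s).card : ℝ)) =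
      (c.P ^ T *ᵥ fun x => expectedVisits c x s) v := by
  rw [c.ex_tower (Nat.zero_le _) (Nat.le_add_right T s)]
  have h : ∀ ω, c.ex T (T + s) ω (fun ω' => ((vis (fun i => ω' (T + i)) s).card : ℝ)) =
      expectedVisits c (ω T) s := by
    intro ω
    have h1 := c.ex_shift T 0 s ω (fun ω' => ((vis ω' s).card : ℝ))
    rw [add_zero] at h1
    rw [h1, expectedVisits_eq]
    refine c.dependsOn_ex (Nat.zero_le s) (fun ω ω' h' => ?_) fun i hi => ?_
    · simp only [vis_congr fun s hs => h' s (Set.mem_Iic.2 hs)]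
    · rw [Nat.le_zero.1 (Set.mem_Iic.1 hi), add_zero]
  simp only [h]
  exact c.ex_eval (Nat.zero_le T) _ fun x => expectedVisits c x s

lemma pow_mulVec_expectedVisits_le (v : V) (T s : ℕ) :
    (c.P ^ T *ᵥ fun x => expectedVisits c x s) v ≤ expectedVisits c v (T + s) := by
  rw [← c.ex_card_vis_shift, ← c.ex_card_vis le_rfl]
  refine c.ex_mono fun ω _ => ?_
  have : vis (fun i => ω (T + i)) s ⊆ vis ω (T + s) := by
    intro x hx
    obtain ⟨i, hi, rfl⟩ := mem_vis.1 hx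
    exact mem_vis.2 ⟨T + i, by omega, rfl⟩
  exact_mod_cast Finset.card_le_card this

lemma expectedVisits_add_le_add (v : V) (T s : ℕ) :
    expectedVisits c v (T + s) ≤
      expectedVisits c v T + (c.P ^ T *ᵥ fun x => expectedVisits c x s) v := by
  rw [← c.ex_card_vis_shift, ← c.ex_card_vis (le_refl (T + s)),
    ← c.ex_card_vis (Nat.le_add_right T s), ← c.ex_add]
  exact c.ex_mono fun ω _ => by exact_mod_cast card_vis_add_le_add ω T s

/-- Doubling the number of steps at most doubles the expected number of visited states, up to the
number of steps after which the chain is well mixed. -/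
lemma expectedVisits_two_mul_le {t₀ : ℕ} (h₀ : Fintype.card V * c.mixErr t₀ ≤ 1) (v : V) (T : ℕ) :
    expectedVisits c v (2 * T) ≤ 2 * expectedVisits c v T + 2 * t₀ + 2 := by
  have ht₀ : (0 : ℝ) ≤ t₀ := Nat.cast_nonneg _
  obtain hT | hT := le_total t₀ T
  -- The second half of the walk starts from the law at time `T`. Comparison through stationarity
  -- with the law at time `t₀` costs at most one visit each way. Shortening the walk to `T - t₀`
  -- steps loses at most `t₀` visits, and what remains is part of the first `T` steps.
  · have hosc : ∀ x y, expectedVisits c x T - expectedVisits c y T ≤ Fintype.card V :=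
      fun x y => by linarith [c.expectedVisits_le_card x T, c.expectedVisits_nonneg y T]
    have h1 := (abs_le.1 (c.abs_pow_mulVec_sub_le_mixErr T hosc v)).2
    have h2 := (abs_le.1 (c.abs_pow_mulVec_sub_le_mixErr t₀ hosc v)).1
    have h3 : c.mixErr T * Fintype.card V ≤ c.mixErr t₀ * Fintype.card V :=
      mul_le_mul_of_nonneg_right (c.mixErr_anti hT) (Nat.cast_nonneg _)
    have h4 := c.expectedVisits_add_le_add v T T
    have h5 : (c.P ^ t₀ *ᵥ fun x => expectedVisits c x T) v ≤
        (c.P ^ t₀ *ᵥ fun x => expectedVisits c x (T - t₀)) v + t₀ := by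
      have e : ∑ x, (c.P ^ t₀) v x * (t₀ : ℝ) = t₀ := by
        rw [← Finset.sum_mul, sum_row_of_mem_rowStochastic (c.pow_stochastic t₀), one_mul]
      rw [← e, mulVec, mulVec, dotProduct, dotProduct, ← Finset.sum_add_distrib]
      refine Finset.sum_le_sum fun x _ => ?_
      rw [← mul_add]
      refine mul_le_mul_of_nonneg_left ?_ (nonneg_of_mem_rowStochastic (c.pow_stochastic t₀))
      have := c.expectedVisits_add_le x (T - t₀) t₀
      rwa [Nat.sub_add_cancel hT] at this
    have h6 := c.pow_mulVec_expectedVisits_le v t₀ (T - t₀)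
    rw [Nat.add_sub_cancel' hT] at h6
    rw [two_mul T]
    linarith
  · have h1 := c.expectedVisits_add_le v 0 (2 * T)
    rw [c.expectedVisits_zero, zero_add] at h1
    have h2 : (T : ℝ) ≤ t₀ := by exact_mod_cast hT
    push_cast at h1
    linarith [c.expectedVisits_nonneg v T]

/-- The expected number of visited states of a set of small stationary mass. -/
lemma ex_card_vis_inter_le (hτ : 0 < c.mixingTime) (v : V) {T j : ℕ} (hT : T ≤ j) (S : Finset V) :
    c.ex 0 j (fun _ => v) (fun ω => ((vis ω T ∩ S).card : ℝ)) ≤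
      (T + 1) * c.setMass S + 2 * c.mixingTime := by
  calc c.ex 0 j (fun _ => v) (fun ω => ((vis ω T ∩ S).card : ℝ))
      ≤ c.ex 0 j (fun _ => v) (fun ω => ∑ s ∈ Finset.range (T + 1), ind S (ω s)) := by
        refine c.ex_mono fun ω _ => ?_
        have : vis ω T ∩ S ⊆ ((Finset.range (T + 1)).filter fun s => ω s ∈ S).image ω := by
          intro x hx
          obtain ⟨hx1, hx2⟩ := Finset.mem_inter.1 hx
          obtain ⟨s, hs, rfl⟩ := mem_vis.1 hx1
          exact Finset.mem_image.2 ⟨s, Finset.mem_filter.2 ⟨Finset.mem_range.2 (by omega), hx2⟩, rfl⟩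
        have h := (Finset.card_le_card this).trans Finset.card_image_le
        simp only [ind, Finset.sum_boole]
        exact_mod_cast h
    _ = ∑ s ∈ Finset.range (T + 1), (c.P ^ s *ᵥ ind S) v := by
        rw [c.ex_sum]
        refine Finset.sum_congr rfl fun s hs => ?_
        have hs := Finset.mem_range.1 hs
        rw [c.ex_of_dependsOn (Nat.zero_le s) (show s ≤ j by omega)
          (fun ω ω' h => by simp only [h s (Set.mem_Iic.2 le_rfl)]),
          c.ex_eval (Nat.zero_le s) _ (ind S), Nat.sub_zero]
    -- The start at `v` is not stationary, but the mixing errors are summable and cost `2 τ` in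
    -- total.
    _ ≤ ∑ s ∈ Finset.range (T + 1), (c.setMass S + c.mixErr s) := by
        refine Finset.sum_le_sum fun s _ => ?_
        have h := (abs_le.1 (c.abs_pow_mulVec_sub_le_mixErr s (ind_osc S) v)).2
        rw [c.π_dotProduct_ind] at h
        linarith
    _ ≤ _ := by
        rw [Finset.sum_add_distrib, Finset.sum_const, Finset.card_range, nsmul_eq_mul]
        push_cast
        linarith [c.sum_mixErr_le hτ (T + 1)]

/-- The states of a set that are not light contribute to its stationary mass. -/
lemma card_sdiff_mul_le (R : Finset V) (θ : ℝ) :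
    ((R \ Finset.univ.filter fun x => c.π x < θ).card : ℝ) * θ ≤ c.setMass R := by
  refine le_trans ?_ (c.setMass_mono
    (Finset.sdiff_subset (s := R) (t := Finset.univ.filter fun x => c.π x < θ)))
  rw [← nsmul_eq_mul]
  refine Finset.card_nsmul_le_sum _ _ _ fun x hx => ?_
  have hx2 := (Finset.mem_sdiff.1 hx).2
  rw [Finset.mem_filter, not_and, not_lt] at hx2
  exact hx2 (Finset.mem_univ x)

/-- A bound on the accumulated mass bounds the number of samples tested after time `T`. -/
lemma exists_mul_le_of_mass_le {t T j : ℕ} (ht : 0 < t) {ω : ℕ → V} {a K : ℝ}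
    (ha : a ≤ c.setMass (vis ω T)) (hK : c.mass t ω j ≤ K) :
    ∃ d : ℕ, d * a ≤ K ∧ j * t ≤ d * t + (T + t) := by
  have h1 : T ≤ (T / t + 1) * t := by
    rw [mul_comm]
    exact (Nat.lt_mul_div_succ T ht).le
  have h2 : (T / t + 1) * t ≤ T + t := by
    rw [add_mul, one_mul]
    exact Nat.add_le_add_right (Nat.div_mul_le_self T t) t
  -- `T / t + 1` is a sample number from which on every tested set contains the states visited up to
  -- time `T`.
  refine ⟨j - (T / t + 1), ?_, ?_⟩
  · refine le_trans ?_ hK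
    rw [← nsmul_eq_mul, ← Nat.card_Ico]
    refine (Finset.card_nsmul_le_sum (Finset.Ico (T / t + 1) j)
      (fun i => c.setMass (vis ω (i * t))) _ fun i hi => ?_).trans ?_
    · exact ha.trans (c.setMass_mono (vis_mono ω (h1.trans
        (Nat.mul_le_mul_right t (Finset.mem_Ico.1 hi).1))))
    · refine Finset.sum_le_sum_of_subset_of_nonneg ?_ fun _ _ _ => c.setMass_nonneg _
      intro i hi
      exact Finset.mem_range.2 (Finset.mem_Ico.1 hi).2
  · refine le_trans ?_ (Nat.add_le_add_left h2 _)
    rw [← add_mul]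
    exact Nat.mul_le_mul_right t (by omega)

end ReversibleChain

/-! ### The number of visited states -/

lemma clog_two_le {n : ℕ} (hn : 2 ≤ n) : (Nat.clog 2 n : ℝ) ≤ 3 * Real.log n := by
  have h1 : 2 ^ (Nat.clog 2 n - 1) < n := Nat.pow_pred_clog_lt_self (by norm_num) (by omega)
  have h2 : 0 < Nat.clog 2 n := Nat.clog_pos (by norm_num) (by omega)
  have h3 : Real.log ((2 : ℝ) ^ (Nat.clog 2 n - 1)) ≤ Real.log n := by
    refine Real.log_le_log (by positivity) ?_
    exact_mod_cast h1.le
  rw [Real.log_pow, Nat.cast_sub h2, Nat.cast_one] at h3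
  -- Both `clog - 1` and `1` are at most `log n / log 2`, and `2 / log 2 < 3`.
  have h4 : Real.log 2 ≤ Real.log n := Real.log_le_log (by norm_num) (by exact_mod_cast hn)
  have h5 := Real.log_two_gt_d9
  have h6 : (1 : ℝ) ≤ Nat.clog 2 n := by exact_mod_cast h2
  nlinarith

/-- The error is halved `⌈log₂ n⌉` times. -/
lemma card_mul_mixErr_clog_le {V : Type} [Fintype V] [DecidableEq V] (c : ReversibleChain V)
    (hτ : 0 < c.mixingTime) :
    Fintype.card V * c.mixErr (c.mixingTime * Nat.clog 2 (Fintype.card V)) ≤ 1 := by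
  have h : ((Fintype.card V : ℕ) : ℝ) ≤ 2 ^ Nat.clog 2 (Fintype.card V) := by
    exact_mod_cast Nat.le_pow_clog (by norm_num) _
  rw [ReversibleChain.mixErr, Nat.mul_div_cancel_left _ hτ, one_div, inv_pow, ← div_eq_mul_inv]
  exact div_le_one_of_le₀ h (by positivity)

/-- The quantity `τ ln n + √(τ̄ n)`, for a given value of `τ̄`. -/
def TargetChain.budget (X : TargetChain) (τb : ℝ) : ℝ :=
  X.chain.mixingTime * Real.log X.n + √(τb * X.n)

namespace TargetChain

variable (X : TargetChain)

lemma one_le_mixingTime : (1 : ℝ) ≤ X.chain.mixingTime := by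
  exact_mod_cast X.chain.mixingTime_pos (by simpa using X.two_le)

lemma log_two_le : Real.log 2 ≤ Real.log X.n :=
  Real.log_le_log (by norm_num) (by exact_mod_cast X.two_le)

lemma half_le_log : 1 / 2 ≤ Real.log X.n := by
  linarith [X.log_two_le, Real.log_two_gt_d9]

lemma half_le_mul_log : 1 / 2 ≤ X.chain.mixingTime * Real.log X.n := by
  nlinarith [X.one_le_mixingTime, X.half_le_log]

lemma half_mixingTime_le : X.chain.mixingTime / 2 ≤ X.chain.mixingTime * Real.log X.n := by
  nlinarith [X.one_le_mixingTime, X.half_le_log]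

set_option maxHeartbeats 400000 in
/-- With large probability, the accumulated mass exceeds a given level before the number of visited
states exceeds a constant multiple of `τ ln n + √(τ̄ n)`. -/
theorem exists_visits_bound {δ c₁ A K L : ℝ} (hδ : 0 < δ) (hc₁ : 0 < c₁) (hA : 0 < A)
    (hK : 0 < K) (hL : 1 ≤ L) :
    ∃ F : ℝ, ∀ (X : TargetChain) (τb : ℝ) (t ℓ q : ℕ), 0 < τb → 0 < t → t ≤ A * τb →
      ((ℓ + 1) * t : ℝ) ≤ A * (X.chain.mixingTime * Real.log X.n) →
      (L ≤ X.n → ∀ T, L * τb ≤ X.visits T →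
        X.chain.pr T (fun _ => X.target) (fun ω => (vis ω T).card < c₁ * X.visits T) ≤ δ / 3) →
      X.chain.pr ((q + ℓ) * t) (fun _ => X.target) (fun ω => ∃ j ≤ q, X.chain.mass t ω j ≤ K ∧
        F * X.budget τb < (vis ω ((j + ℓ) * t)).card) ≤ δ := by
  -- The summands make `B = C y` large enough in turn: `L` for the concentration hypothesis, `48 /
  -- (δ c₁)` for `2 τ` to be negligible among light visits, and the last one for the passes after
  -- `T₁` to fit into `T₁ + 1` steps.
  set C : ℝ := 1 + L + 48 / (δ * c₁) + 24 * K * A / (δ * c₁ ^ 2) with hC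
  have hC1 : 0 ≤ 48 / (δ * c₁) := by positivity
  have hC2 : 0 ≤ 24 * K * A / (δ * c₁ ^ 2) := by positivity
  have hCpos : 1 ≤ C := by linarith
  -- The first summand makes the Markov bounds at most `δ / 3`.
  set F : ℝ := 3 * (2 * C + 16 + A) / δ + 2 * L with hF
  have hF1 : 3 * (2 * C + 16 + A) / δ ≤ F := by linarith
  have hF0 : 0 < F := by positivity
  refine ⟨F, fun X τb t ℓ q hτb ht htA hℓA hconc => ?_⟩
  set c := X.chain
  set v := X.target
  set n : ℝ := (X.n : ℝ) with hn
  set y := X.budget τb with hy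
  set H := (q + ℓ) * t with hH
  have hτ1 := X.one_le_mixingTime
  have hτ0 : 0 < c.mixingTime := c.mixingTime_pos (by simpa using X.two_le)
  have hn2 : 2 ≤ n := by
    rw [hn]
    exact_mod_cast X.two_le
  have hy1 : c.mixingTime * Real.log n ≤ y := by
    rw [hy, budget]
    linarith [Real.sqrt_nonneg (τb * X.n)]
  have hy2 : √(τb * n) ≤ y := by
    rw [hy, budget]
    have := X.half_le_mul_log
    linarith
  have hyhalf : 1 / 2 ≤ y := X.half_le_mul_log.trans hy1
  have hy0 : 0 < y := by linarith
  have hcard : ∀ (ω : ℕ → Fin X.n) (m : ℕ), ((vis ω m).card : ℝ) ≤ n := fun ω m => by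
    have := Finset.card_le_univ (vis ω m)
    rw [Fintype.card_fin] at this
    rw [hn]
    exact_mod_cast this
  have hFδ : ∀ {a p : ℝ}, F * y * p ≤ a * y → 3 * a ≤ 3 * (2 * C + 16 + A) → p ≤ δ / 3 := by
    intro a p h1 h2
    have h3 : F * p ≤ a := by
      refine le_of_mul_le_mul_right ?_ hy0
      linarith
    by_contra! hp
    have h4 : 3 * (2 * C + 16 + A) ≤ F * δ := (div_le_iff₀ hδ).1 hF1
    have h5 := mul_lt_mul_of_pos_left hp hF0
    linarith
  -- No walk visits more than `n` states. In the other case `n > F y ≥ L`, because `F ≥ 2 L` and `y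
  -- ≥ 1/2`; so the concentration hypothesis applies.
  by_cases htriv : n ≤ F * y
  · refine (c.pr_mono (E' := fun _ => False) ?_).trans (by rw [c.pr_false]; exact hδ.le)
    rintro ω ⟨j, -, -, h⟩
    linarith [hcard ω ((j + ℓ) * t)]
  push Not at htriv
  have hLn : L ≤ X.n := by
    have h1 : 2 * L ≤ F := by
      have : 0 ≤ 3 * (2 * C + 16 + A) / δ := by positivity
      linarith
    have h2 : 2 * L * (1 / 2) ≤ F * y := mul_le_mul h1 hyhalf (by norm_num) hF0.le
    rw [← hn]
    linarith
  set B := C * y with hB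
  have hB0 : 0 < B := by positivity
  -- Failure would force `√(τ̄ n) < τ̄`, hence `n < τ̄` and `n ≤ √(τ̄ n) ≤ y`, the trivial case
  -- again.
  have hBL : L * τb ≤ B := by
    have h1 : L * √(τb * n) ≤ B := mul_le_mul (by linarith) hy2 (Real.sqrt_nonneg _) (by linarith)
    by_contra! hlt
    have h2 : √(τb * n) < τb := by
      refine lt_of_mul_lt_mul_left (h1.trans_lt hlt) (by linarith)
    have h3 : n < τb := by
      rw [Real.sqrt_lt' hτb, sq] at h2
      exact lt_of_mul_lt_mul_left h2 hτb.le
    have h4 : n ≤ √(τb * n) := Real.le_sqrt_of_sq_le (by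
      rw [sq]
      exact mul_le_mul_of_nonneg_right h3.le (by linarith))
    have h5 : 1 ≤ F := by
      have : 0 ≤ 3 * (2 * C + 16 + A) / δ := by positivity
      linarith
    have h6 : y ≤ F * y := le_mul_of_one_le_left hy0.le h5
    linarith
  have hBsq : C * (τb * n) ≤ B ^ 2 := by
    have h1 : τb * n ≤ y ^ 2 := by
      rw [← Real.sq_sqrt (show 0 ≤ τb * n by positivity)]
      exact pow_le_pow_left₀ (Real.sqrt_nonneg _) hy2 2
    have h2 : C ≤ C ^ 2 := le_self_pow₀ hCpos two_ne_zero
    rw [hB, mul_pow]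
    exact mul_le_mul h2 h1 (by positivity) (by positivity)
  have hmarkov : ∀ T ≤ H, F * y * c.pr H (fun _ => v) (fun ω => F * y < (vis ω T).card) ≤
      X.visits T := by
    intro T hT
    rw [visits, ← c.ex_card_vis hT]
    exact c.mul_pr_le (fun _ => Nat.cast_nonneg _) fun ω h => h.le
  -- If `B` is not reached within the horizon, Markov's inequality at time `H` is enough.
  by_cases hex : ∃ T, T ≤ H ∧ B ≤ X.visits T
  swap
  · push Not at hex
    have h1 : c.pr H (fun _ => v) (fun ω => F * y < (vis ω H).card) ≤ δ / 3 :=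
      hFδ (a := C) ((hmarkov H le_rfl).trans (hex H le_rfl).le) (by linarith)
    refine (c.pr_mono ?_).trans (h1.trans (by linarith))
    rintro ω ⟨j, hj, -, h⟩
    refine h.trans_le ?_
    exact_mod_cast Finset.card_le_card
      (vis_mono ω (Nat.mul_le_mul_right t (Nat.add_le_add_right hj ℓ)))
  set T₁ := Nat.find hex with hT₁
  obtain ⟨hT₁H, hT₁B⟩ := Nat.find_spec hex
  rw [← hT₁] at hT₁H hT₁B
  have hT₁B' : X.visits T₁ ≤ B + 1 := by
    rcases Nat.eq_zero_or_pos T₁ with h0 | h0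
    · rw [h0, visits, c.expectedVisits_zero]
      linarith
    · have h1 := Nat.find_min hex (m := T₁ - 1) (by omega)
      have h2 : X.visits (T₁ - 1) < B := by
        by_contra! h3
        exact h1 ⟨by omega, h3⟩
      have h3 := c.expectedVisits_add_le v (T₁ - 1) 1
      rw [Nat.sub_add_cancel h0, Nat.cast_one] at h3
      simp only [visits] at h2 ⊢
      linarith
  -- All light states together have mass at most `n θ`. The choice of `θ` bounds the stationary part
  -- `(T₁ + 1) n θ` of the expected visits to them by `c₁ B δ / 12`, and `2 τ` obeys the same bound.
  -- So with probability at least `1 - δ / 3` they account for at most half of `c₁ B`.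
  set θ : ℝ := c₁ * B * δ / (12 * (T₁ + 1) * n) with hθ
  have hθ0 : 0 < θ := by positivity
  set S : Finset (Fin X.n) := Finset.univ.filter fun x => c.π x < θ with hS
  have hSmass : c.setMass S ≤ n * θ := by
    refine (Finset.sum_le_card_nsmul S _ θ fun x hx => (Finset.mem_filter.1 hx).2.le).trans ?_
    rw [nsmul_eq_mul]
    refine mul_le_mul_of_nonneg_right ?_ hθ0.le
    have := Finset.card_le_univ S
    rw [Fintype.card_fin] at this
    rw [hn]
    exact_mod_cast this
  have hE1 : c.pr H (fun _ => v) (fun ω => (vis ω T₁).card < c₁ * X.visits T₁) ≤ δ / 3 := by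
    rw [c.pr_of_dependsOn hT₁H fun ω ω' h => by
      simp only [vis_congr fun s hs => h s (Set.mem_Iic.2 hs)]]
    exact hconc hLn T₁ (hBL.trans hT₁B)
  have hE2 : c.pr H (fun _ => v) (fun ω => c₁ * B / 2 < (vis ω T₁ ∩ S).card) ≤ δ / 3 := by
    have h1 := (c.mul_pr_le (j := H) (ω := fun _ => v) (a := c₁ * B / 2)
      (E := fun ω => c₁ * B / 2 < (vis ω T₁ ∩ S).card)
      (F := fun ω => ((vis ω T₁ ∩ S).card : ℝ)) (fun _ => Nat.cast_nonneg _)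
      fun ω h => le_of_lt h).trans (c.ex_card_vis_inter_le hτ0 v hT₁H S)
    have h2 : (T₁ + 1) * c.setMass S ≤ c₁ * B * δ / 12 := by
      calc (T₁ + 1) * c.setMass S ≤ (T₁ + 1) * (n * θ) :=
            mul_le_mul_of_nonneg_left hSmass (by positivity)
        _ = c₁ * B * δ / 12 := by
            rw [hθ]
            field_simp
    have h3 : 2 * (c.mixingTime : ℝ) ≤ c₁ * B * δ / 12 := by
      have h4 : 48 / (δ * c₁) ≤ C := by linarith
      rw [div_le_iff₀ (by positivity)] at h4
      have h5 := X.half_mixingTime_le.trans hy1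
      have h6 : 48 * y ≤ C * (δ * c₁) * y := mul_le_mul_of_nonneg_right h4 hy0.le
      have h7 : c₁ * B * δ = C * (δ * c₁) * y := by rw [hB]; ring
      rw [h7]
      linarith
    have h4 : c₁ * B / 2 * c.pr H (fun _ => v) (fun ω => c₁ * B / 2 < (vis ω T₁ ∩ S).card) ≤
        c₁ * B / 2 * (δ / 3) := by linarith
    exact le_of_mul_le_mul_left h4 (by positivity)
  -- A bound on the halting time: `T₁`, at most `T₁ + 1` further steps of sampling, one interval for
  -- rounding and the lag `ℓ t`. It is capped at the horizon.
  set T₃ := min (2 * T₁ + (1 + (ℓ + 1) * t)) H with hT₃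
  have hE3 : c.pr H (fun _ => v) (fun ω => F * y < (vis ω T₃).card) ≤ δ / 3 := by
    refine hFδ (a := 2 * C + 16 + A) ((hmarkov T₃ (min_le_right _ _)).trans ?_) le_rfl
    set t₀ := c.mixingTime * Nat.clog 2 X.n with ht₀
    have h0 : Fintype.card (Fin X.n) * c.mixErr t₀ ≤ 1 := by
      have := card_mul_mixErr_clog_le c hτ0
      rwa [Fintype.card_fin] at this ⊢
    have h1 : X.visits T₃ ≤ X.visits (2 * T₁ + (1 + (ℓ + 1) * t)) :=
      c.expectedVisits_mono v (min_le_left _ _)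
    have h2 : X.visits (2 * T₁ + (1 + (ℓ + 1) * t)) ≤
        X.visits (2 * T₁) + (1 + (ℓ + 1) * t : ℕ) := c.expectedVisits_add_le v _ _
    have h3 : X.visits (2 * T₁) ≤ 2 * X.visits T₁ + 2 * t₀ + 2 :=
      c.expectedVisits_two_mul_le h0 v T₁
    have h4 : (t₀ : ℝ) ≤ 3 * (c.mixingTime * Real.log n) := by
      rw [ht₀, Nat.cast_mul]
      have := mul_le_mul_of_nonneg_left (clog_two_le X.two_le) (Nat.cast_nonneg c.mixingTime)
      linarith
    have h5 : A * (c.mixingTime * Real.log n) ≤ A * y := mul_le_mul_of_nonneg_left hy1 hA.le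
    have h6 : (2 * C + 16 + A) * y = 2 * B + 16 * y + A * y := by rw [hB]; ring
    push_cast at h2
    linarith
  have hsub : ∀ ω : ℕ → Fin X.n, (∃ j ≤ q, c.mass t ω j ≤ K ∧
      F * y < (vis ω ((j + ℓ) * t)).card) →
        ((vis ω T₁).card < c₁ * X.visits T₁ ∨ c₁ * B / 2 < (vis ω T₁ ∩ S).card) ∨
          F * y < (vis ω T₃).card := by
    rintro ω ⟨j, hj, hjK, hjF⟩
    by_contra! hcon
    obtain ⟨⟨hc1, hc2⟩, hc3⟩ := hcon
    refine absurd hjF (not_lt.2 (le_trans ?_ hc3))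
    have hle : (j + ℓ) * t ≤ T₃ := by
      refine le_min ?_ (Nat.mul_le_mul_right t (by omega))
      have hheavy : c₁ * B / 2 ≤ ((vis ω T₁ \ S).card : ℝ) := by
        have h1 := Finset.card_sdiff_add_card_inter (vis ω T₁) S
        have h2 : ((vis ω T₁ \ S).card : ℝ) + (vis ω T₁ ∩ S).card = (vis ω T₁).card := by
          exact_mod_cast h1
        have h3 : c₁ * B ≤ c₁ * X.visits T₁ := mul_le_mul_of_nonneg_left hT₁B hc₁.le
        linarith
      have hmass : c₁ * B / 2 * θ ≤ c.setMass (vis ω T₁) := by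
        exact (mul_le_mul_of_nonneg_right hheavy hθ0.le).trans (c.card_sdiff_mul_le _ θ)
      -- Each of the `d` late samples adds at least `c₁ B θ / 2 = c₁² B² δ / (24 (T₁ + 1) n)` to a
      -- mass that is at most `K`. With `B² ≥ C τ̄ n` and `t ≤ A τ̄`, the choice of `C` yields `d t
      -- ≤ T₁ + 1`.
      obtain ⟨d, hd1, hd2⟩ := c.exists_mul_le_of_mass_le ht hmass hjK
      have hjt : (d * t : ℝ) ≤ T₁ + 1 := by
        have hd : (0 : ℝ) ≤ d := Nat.cast_nonneg _
        have h1 := hd1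
        have h2 : d * (c₁ ^ 2 * B ^ 2 * δ) ≤ K * (24 * (T₁ + 1) * n) := by
          have e : d * (c₁ * B / 2 * θ) = d * (c₁ ^ 2 * B ^ 2 * δ) / (24 * (T₁ + 1) * n) := by
            rw [hθ]
            field_simp
            ring
          rwa [e, div_le_iff₀ (by positivity)] at h1
        have h3 : d * (c₁ ^ 2 * (C * (τb * n)) * δ) ≤ K * (24 * (T₁ + 1) * n) := by
          refine le_trans ?_ h2
          gcongr
        have h4 : d * (c₁ ^ 2 * (C * τb) * δ) ≤ K * (24 * (T₁ + 1)) := by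
          refine le_of_mul_le_mul_right ?_ (show 0 < n by linarith)
          linarith
        have h5 : 24 * K * A ≤ C * (δ * c₁ ^ 2) := by
          rw [← div_le_iff₀ (by positivity)]
          linarith
        have h6 : d * τb * (24 * K * A) ≤ K * (24 * (T₁ + 1)) := by
          refine le_trans (mul_le_mul_of_nonneg_left h5 (by positivity)) ?_
          linarith
        have h7 : 24 * K * (d * (A * τb)) ≤ 24 * K * (T₁ + 1) := by linarith
        have h8 : d * (A * τb) ≤ T₁ + 1 := le_of_mul_le_mul_left h7 (by positivity)
        exact (mul_le_mul_of_nonneg_left htA hd).trans h8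
      have hjt' : d * t ≤ T₁ + 1 := by exact_mod_cast hjt
      have e1 : (j + ℓ) * t = j * t + ℓ * t := by ring
      have e2 : (ℓ + 1) * t = ℓ * t + t := by ring
      rw [e1, e2]
      omega
    exact_mod_cast Finset.card_le_card (vis_mono ω hle)
  refine (c.pr_mono hsub).trans ((c.pr_or_le _ _ _ _).trans ?_)
  have := c.pr_or_le H (fun _ => v) (fun ω => (vis ω T₁).card < c₁ * X.visits T₁)
    (fun ω => c₁ * B / 2 < (vis ω T₁ ∩ S).card)
  linarith

end TargetChain

namespace ReversibleChain

variable {V : Type} [Fintype V] [DecidableEq V] (c : ReversibleChain V)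

/-! ### Reduction to tail bounds -/

lemma outcome_nonneg (v : V) (k t ℓ : ℕ) {g : ℝ → Finset V → ℝ} (hg : ∀ x S, 0 ≤ g x S)
    (fuel m : ℕ) (ω : ℕ → V) : 0 ≤ c.outcome v k t ℓ g fuel m ω := by
  induction fuel generalizing m with
  | zero => exact hg _ _
  | succ fuel ih =>
    rw [outcome]
    split_ifs
    · exact ih _
    · exact hg _ _

/-- The probability of a good outcome is bounded in terms of the tails of the number of samples that
fall into truncated visited sets, and of the number of visited states. -/
theorem le_ex_outcome {v : V} {k t ℓ Q : ℕ} (hk : 0 < k)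
    (hQ : Q = (ℓ + 1) * (Fintype.card V + k)) {ε R p₁ p₂ p₃ : ℝ} (hε0 : 0 < ε) (hε1 : ε < 1)
    {g : ℝ → Finset V → ℝ} (hg0 : ∀ x S, 0 ≤ g x S)
    (hg1 : ∀ x S, ((1 - ε) * c.π v ≤ x ∧ x ≤ (1 + ε) * c.π v) ∧ (S.card : ℝ) ≤ R → g x S = 1)
    (h₁ : c.pr ((Q + ℓ) * t) (fun _ => v)
      (fun ω => k ≤ hitsIn t ℓ (c.setsBelow t (k / (1 + ε))) ω Q) ≤ p₁)
    (h₂ : c.pr ((Q + ℓ) * t) (fun _ => v)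
      (fun ω => hitsIn t ℓ (c.setsUntil t (k / (1 - ε))) ω Q ≤ k ∧
        k / (1 - ε) < c.massIn (c.setsUntil t (k / (1 - ε))) ω Q) ≤ p₂)
    (h₃ : c.pr ((Q + ℓ) * t) (fun _ => v)
      (fun ω => ∃ j ≤ Q, c.mass t ω j ≤ k / (1 - ε) ∧ R < (vis ω ((j + ℓ) * t)).card) ≤ p₃) :
    1 - (p₁ + p₂ + p₃) ≤ c.ex 0 ((Q + ℓ) * t) (fun _ => v) (c.outcome v k t ℓ g (Q + ℓ) 0) := by
  classical
  have hcard : 0 < Fintype.card V := Fintype.card_pos_iff.2 ⟨v⟩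
  have hQ0 : (ℓ + 1) * (Fintype.card V + k - 1) + (ℓ + 1) = Q := by
    rw [hQ, ← Nat.mul_succ]
    congr 1
    omega
  have h := (c.pr_or_le ((Q + ℓ) * t) (fun _ => v)
    (fun ω => k ≤ hitsIn t ℓ (c.setsBelow t (k / (1 + ε))) ω Q ∨
      (hitsIn t ℓ (c.setsUntil t (k / (1 - ε))) ω Q ≤ k ∧
        k / (1 - ε) < c.massIn (c.setsUntil t (k / (1 - ε))) ω Q)) _).trans
    (add_le_add ((c.pr_or_le _ _ _ _).trans (add_le_add h₁ h₂)) h₃)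
  refine (sub_le_sub_left h 1).trans ?_
  refine (congrArg (fun a => a - c.pr _ _ _)
    (c.ex_const 0 ((Q + ℓ) * t) (fun _ => v) 1)).ge.trans ?_
  rw [pr, ← c.ex_sub]
  refine c.ex_mono fun ω _ => ?_
  split_ifs with hbad
  · rw [sub_self]
    exact c.outcome_nonneg v k t ℓ hg0 _ _ _
  · rw [sub_zero]
    push Not at hbad
    obtain ⟨⟨hb1, hb2⟩, hb3⟩ := hbad
    refine le_of_eq (Eq.symm ?_)
    have hkR : (0 : ℝ) < k := by exact_mod_cast hk
    rw [show Q + ℓ = Q - 1 + ℓ + 1 by omega]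
    refine c.outcome_eq_one hk ((le_hits t ℓ k ω).trans (hits_mono t ℓ ω (by omega))) ?_
    -- Outside the bad events, the mass at the `k`-th hit lies between `k / (1 + ε)` and `k / (1 -
    -- ε)`; a mass beyond either level would show in the corresponding truncated count.
    intro j hj hjk
    have hlow : k / (1 + ε) < c.mass t ω j := by
      by_contra! hc
      have := c.hits_le_hitsIn_setsBelow (ℓ := ℓ) (show j ≤ Q by omega) hc
      omega
    have hupp : c.mass t ω j ≤ k / (1 - ε) := by
      by_contra! hc
      have h1 := c.hitsIn_setsUntil_le_hits (ℓ := ℓ) (q := Q) hc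
      have h2 := c.lt_massIn_setsUntil (show j ≤ Q by omega) hc
      linarith [hb2 (h1.trans hjk.le)]
    have hm : 0 < c.mass t ω j := lt_trans (by positivity) hlow
    refine hg1 _ _ ?_
    rw [div_lt_iff₀ (by linarith)] at hlow
    rw [le_div_iff₀ (by linarith)] at hupp
    have hπ := c.π_pos v
    rw [div_div_eq_mul_div, le_div_iff₀ hm, div_le_iff₀ hm]
    refine ⟨⟨?_, ?_⟩, hb3 j (by omega) ?_⟩
    · nlinarith
    · nlinarith
    · rwa [le_div_iff₀ (by linarith)]

/-! ### Exponential tail bounds -/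

/-- The Chernoff rate per hit for `a = 1 + ε` at mass level `k / (1 + ε)`. It follows from `log (1 +
ε) ≥ 2 ε / (2 + ε)`. -/
lemma sq_div_eight_le_log_one_add {ε : ℝ} (h0 : 0 < ε) (h1 : ε < 1) :
    ε ^ 2 / 8 ≤ Real.log (1 + ε) - ε / (1 + ε) := by
  have h := Real.le_log_one_add_of_nonneg h0.le
  have h2 : ε ^ 2 / 8 ≤ 2 * ε / (ε + 2) - ε / (1 + ε) := by
    rw [div_sub_div _ _ (by linarith) (by linarith), div_le_div_iff₀ (by norm_num) (by nlinarith)]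
    nlinarith [mul_pos h0 h0, mul_pos (mul_pos h0 h0) (sub_pos.2 h1)]
  linarith

/-- The rate on the other side, from `x ≤ sinh x` at `x = log (1 - ε)⁻¹`. -/
lemma sq_div_eight_le_log_one_sub {ε : ℝ} (h0 : 0 < ε) (h1 : ε < 1) :
    ε ^ 2 / 8 ≤ Real.log (1 - ε) + ε / (1 - ε) := by
  have h1' : 0 < 1 - ε := by linarith
  have hlog : 0 ≤ Real.log (1 - ε)⁻¹ :=
    Real.log_nonneg ((one_le_inv₀ h1').2 (by linarith))
  have h := Real.self_le_sinh_iff.2 hlog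
  rw [Real.sinh_log (by positivity), inv_inv, Real.log_inv] at h
  have h2 : ε ^ 2 / 8 ≤ ε / (1 - ε) - ((1 - ε)⁻¹ - (1 - ε)) / 2 := by
    have e : ε / (1 - ε) - ((1 - ε)⁻¹ - (1 - ε)) / 2 = ε ^ 2 / (2 * (1 - ε)) := by
      field_simp
      ring
    rw [e]
    exact div_le_div_of_nonneg_left (by positivity) (by linarith) (by linarith)
  linarith

lemma exp_tenth_le : Real.exp (1 / 10) ≤ 10 / 9 := by
  have h := Real.add_one_le_exp (-(1 / 10) : ℝ)
  rw [Real.exp_neg] at h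
  have h2 := Real.exp_pos (1 / 10)
  have h3 : (9 / 10 : ℝ) ≤ (Real.exp (1 / 10))⁻¹ := by linarith
  rw [le_inv_comm₀ (by norm_num) h2] at h3
  linarith

section ExponentialTails

variable {v : V} {k t Q : ℕ} {ε δ : ℝ}

/-- The Chernoff factor is at most `δ / 3` and the mixing errors contribute at most `10 / 9`; the
product `10 δ / 27` is below `2 δ / 5`. -/
lemma exp_mul_le (hk : Real.log (3 / δ) ≤ k * (ε ^ 2 / 8)) (hδ : 0 < δ) (hε1 : ε < 1)
    (hε0 : 0 < ε) (herr : Q * c.mixErr t ≤ 1 / 10) {p x : ℝ} (hx : k * (ε ^ 2 / 8) ≤ x)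
    (hp : Real.exp x * p ≤ Real.exp (Q * (ε * c.mixErr t))) : p ≤ 2 / 5 * δ := by
  have h1 : Real.exp (Q * (ε * c.mixErr t)) ≤ 10 / 9 := by
    refine (Real.exp_le_exp.2 ?_).trans exp_tenth_le
    have : 0 ≤ Q * c.mixErr t := mul_nonneg (Nat.cast_nonneg _) (c.mixErr_nonneg t)
    nlinarith
  have h2 : 3 / δ ≤ Real.exp x := by
    rw [← Real.log_le_iff_le_exp (by positivity)]
    linarith
  by_contra! hc
  have h3 : 3 / δ * (2 / 5 * δ) < Real.exp x * p :=
    mul_lt_mul' h2 hc (by positivity) (Real.exp_pos x)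
  have h4 : 3 / δ * (2 / 5 * δ) = 6 / 5 := by
    field_simp
    norm_num
  linarith

/-- Markov's inequality for the exponential moment with `a = 1 + ε`. The truncated mass never
exceeds `θ`, so `k` hits force the integrand above `(1 + ε)^k exp (-ε θ)`. The other tail uses `a =
1 - ε`. -/
lemma pr_le_hitsIn_setsBelow_le (hk : Real.log (3 / δ) ≤ k * (ε ^ 2 / 8)) (hδ : 0 < δ)
    (hε1 : ε < 1) (hε0 : 0 < ε) (herr : Q * c.mixErr t ≤ 1 / 10) :
    c.pr (Q * t) (fun _ => v) (fun ω => k ≤ hitsIn t 0 (c.setsBelow t (k / (1 + ε))) ω Q) ≤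
      2 / 5 * δ := by
  set θ : ℝ := k / (1 + ε) with hθ
  have hθ0 : 0 ≤ θ := by positivity
  have h := c.ex_pow_hitsIn_le t (c.dependsOn_setsBelow t θ) (a := 1 + ε) (by linarith) Q
    (fun _ => v)
  have hx : Real.exp (k * Real.log (1 + ε) - ε * θ) =
      (1 + ε) ^ k * Real.exp (-((1 + ε - 1) * θ)) := by
    rw [← Real.rpow_natCast, Real.rpow_def_of_pos (by linarith), ← Real.exp_add]
    congr 1
    ring
  have hM := c.mul_pr_le (j := Q * t) (ω := fun _ => v)
    (E := fun ω => k ≤ hitsIn t 0 (c.setsBelow t θ) ω Q)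
    (a := Real.exp (k * Real.log (1 + ε) - ε * θ))
    (F := fun ω => (1 + ε) ^ hitsIn t 0 (c.setsBelow t θ) ω Q *
      Real.exp (-((1 + ε - 1) * c.massIn (c.setsBelow t θ) ω Q)))
    (fun ω => by positivity) fun ω hω => by
      rw [hx]
      refine mul_le_mul (pow_le_pow_right₀ (by linarith) hω) ?_ (Real.exp_pos _).le (by positivity)
      have := c.massIn_setsBelow_le (t := t) hθ0 ω Q
      exact Real.exp_le_exp.2 (by nlinarith)
  have hM' := hM.trans h
  rw [add_sub_cancel_left, abs_of_pos hε0] at hM'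
  refine c.exp_mul_le hk hδ hε1 hε0 herr ?_ hM'
  have := mul_le_mul_of_nonneg_left (sq_div_eight_le_log_one_add hε0 hε1) (Nat.cast_nonneg k)
  refine this.trans (le_of_eq ?_)
  rw [hθ]
  ring

lemma pr_hitsIn_setsUntil_le (hk : Real.log (3 / δ) ≤ k * (ε ^ 2 / 8)) (hδ : 0 < δ)
    (hε1 : ε < 1) (hε0 : 0 < ε) (herr : Q * c.mixErr t ≤ 1 / 10) :
    c.pr (Q * t) (fun _ => v) (fun ω => hitsIn t 0 (c.setsUntil t (k / (1 - ε))) ω Q ≤ k ∧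
      k / (1 - ε) < c.massIn (c.setsUntil t (k / (1 - ε))) ω Q) ≤ 2 / 5 * δ := by
  set θ : ℝ := k / (1 - ε) with hθ
  have hε' : 0 < 1 - ε := by linarith
  have h := c.ex_pow_hitsIn_le t (c.dependsOn_setsUntil t θ) (a := 1 - ε) hε'.le Q
    (fun _ => v)
  have hx : Real.exp (k * Real.log (1 - ε) + ε * θ) =
      (1 - ε) ^ k * Real.exp (-((1 - ε - 1) * θ)) := by
    rw [← Real.rpow_natCast, Real.rpow_def_of_pos hε', ← Real.exp_add]
    congr 1
    ring
  have hM := c.mul_pr_le (j := Q * t) (ω := fun _ => v)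
    (E := fun ω => hitsIn t 0 (c.setsUntil t θ) ω Q ≤ k ∧ θ < c.massIn (c.setsUntil t θ) ω Q)
    (a := Real.exp (k * Real.log (1 - ε) + ε * θ))
    (F := fun ω => (1 - ε) ^ hitsIn t 0 (c.setsUntil t θ) ω Q *
      Real.exp (-((1 - ε - 1) * c.massIn (c.setsUntil t θ) ω Q)))
    (fun ω => by positivity) fun ω hω => by
      rw [hx]
      refine mul_le_mul (pow_le_pow_of_le_one hε'.le (by linarith) hω.1) ?_ (Real.exp_pos _).le
        (by positivity)
      have := hω.2
      exact Real.exp_le_exp.2 (by nlinarith)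
  have hM' := hM.trans h
  rw [show 1 - ε - 1 = -ε by ring, abs_neg, abs_of_pos hε0] at hM'
  refine c.exp_mul_le hk hδ hε1 hε0 herr ?_ hM'
  have := mul_le_mul_of_nonneg_left (sq_div_eight_le_log_one_sub hε0 hε1) (Nat.cast_nonneg k)
  refine this.trans (le_of_eq ?_)
  rw [hθ]
  ring

end ExponentialTails

/-! ### Tail bounds from second moments -/

section SecondMomentTails

variable {v : V} {k t ℓ L Q : ℕ} {ε δ : ℝ}

lemma sq_mul_pr_le {B : ℕ → (ℕ → V) → Finset V}
    (hB : ∀ i, DependsOn (B i) (Set.Iic (i * t))) (hL : ℓ + 1 = 2 * L)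
    (hmix : ∀ s, c.mixErr (s * t) ≤ (1 / 2) ^ s) (hQ : 2 * (Q : ℝ) ^ 2 * (1 / 2) ^ L ≤ 1)
    {M a : ℝ} (hM : ∀ ω, c.massIn B ω Q ≤ M) {E : (ℕ → V) → Prop}
    (hE : ∀ ω, E ω → a ^ 2 ≤ ((hitsIn t ℓ B ω Q : ℝ) - c.massIn B ω Q) ^ 2) :
    a ^ 2 * c.pr ((Q + ℓ) * t) (fun _ => v) E ≤ 5 * M + 1 := by
  have h1 := (c.mul_pr_le (j := (Q + ℓ) * t) (ω := fun _ => v) (fun _ => sq_nonneg _) hE).trans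
    (c.ex_sq_hitsIn_sub_massIn_le hB hL hmix Q _)
  have h2 : c.ex 0 ((Q + ℓ) * t) (fun _ => v) (fun ω => c.massIn B ω Q) ≤ M := by
    rw [← c.ex_const 0 ((Q + ℓ) * t) (fun _ => v) M]
    exact c.ex_mono fun ω _ => hM ω
  linarith

/-- Chebyshev: the deviation is at least `k ε / 2` and the second moment at most `5 k + 1 ≤ 6 k`, so
the probability is at most `24 / (k ε²)`. This is where `72` comes from. -/
lemma pr_le_hitsIn_setsBelow_le' (hL : ℓ + 1 = 2 * L)
    (hmix : ∀ s, c.mixErr (s * t) ≤ (1 / 2) ^ s) (hQ : 2 * (Q : ℝ) ^ 2 * (1 / 2) ^ L ≤ 1)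
    (hk : 72 / (ε ^ 2 * δ) ≤ k) (hk1 : 1 ≤ k) (hδ : 0 < δ) (hε1 : ε < 1) (hε0 : 0 < ε) :
    c.pr ((Q + ℓ) * t) (fun _ => v)
      (fun ω => k ≤ hitsIn t ℓ (c.setsBelow t (k / (1 + ε))) ω Q) ≤ δ / 3 := by
  have hkR : (1 : ℝ) ≤ k := by exact_mod_cast hk1
  set θ : ℝ := k / (1 + ε) with hθ
  have hθ0 : 0 ≤ θ := by positivity
  have hθk : θ ≤ k := div_le_self (by linarith) (by linarith)
  have hgap : k * ε / 2 ≤ k - θ := by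
    have : k - θ = k * ε / (1 + ε) := by
      rw [hθ]
      field_simp
      ring
    rw [this]
    exact div_le_div_of_nonneg_left (by positivity) (by linarith) (by linarith)
  have h := c.sq_mul_pr_le (v := v) (c.dependsOn_setsBelow t θ) hL hmix hQ (a := k * ε / 2)
    (E := fun ω => k ≤ hitsIn t ℓ (c.setsBelow t θ) ω Q)
    (fun ω => c.massIn_setsBelow_le hθ0 ω Q) fun ω hω => by
      refine pow_le_pow_left₀ (by positivity) ?_ 2
      have h1 := c.massIn_setsBelow_le (t := t) hθ0 ω Q
      have h2 : (k : ℝ) ≤ hitsIn t ℓ (c.setsBelow t θ) ω Q := by exact_mod_cast hω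
      linarith
  rw [div_le_iff₀ (by positivity)] at hk
  by_contra! hc
  have h1 : (k * ε / 2) ^ 2 * (δ / 3) < 6 * k := by
    refine lt_of_lt_of_le (mul_lt_mul_of_pos_left hc (by positivity)) (h.trans ?_)
    linarith
  have h2 : (k * ε / 2) ^ 2 * (δ / 3) = k / 12 * (k * (ε ^ 2 * δ)) := by ring
  have h3 : (k : ℝ) / 12 * 72 ≤ k / 12 * (k * (ε ^ 2 * δ)) :=
    mul_le_mul_of_nonneg_left hk (by positivity)
  linarith

/-- Chebyshev again, with deviation `ε θ` and second moment at most `5 (θ + 1) + 1 ≤ 11 θ`. -/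
lemma pr_hitsIn_setsUntil_le' (hL : ℓ + 1 = 2 * L)
    (hmix : ∀ s, c.mixErr (s * t) ≤ (1 / 2) ^ s) (hQ : 2 * (Q : ℝ) ^ 2 * (1 / 2) ^ L ≤ 1)
    (hk : 72 / (ε ^ 2 * δ) ≤ k) (hk1 : 1 ≤ k) (hδ : 0 < δ) (hε1 : ε < 1) (hε0 : 0 < ε) :
    c.pr ((Q + ℓ) * t) (fun _ => v)
      (fun ω => hitsIn t ℓ (c.setsUntil t (k / (1 - ε))) ω Q ≤ k ∧
        k / (1 - ε) < c.massIn (c.setsUntil t (k / (1 - ε))) ω Q) ≤ δ / 3 := by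
  have hkR : (1 : ℝ) ≤ k := by exact_mod_cast hk1
  have hε' : 0 < 1 - ε := by linarith
  set θ : ℝ := k / (1 - ε) with hθ
  have hkθ : k ≤ θ := le_div_self (by linarith) hε' (by linarith)
  have hθ0 : 0 < θ := by linarith
  have hgap : θ - k = ε * θ := by
    rw [hθ]
    field_simp
    ring
  have h := c.sq_mul_pr_le (v := v) (c.dependsOn_setsUntil t θ) hL hmix hQ (a := ε * θ)
    (E := fun ω => hitsIn t ℓ (c.setsUntil t θ) ω Q ≤ k ∧ θ < c.massIn (c.setsUntil t θ) ω Q)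
    (fun ω => c.massIn_setsUntil_le hθ0.le ω Q) fun ω hω => by
      rw [← neg_sq ((hitsIn t ℓ (c.setsUntil t θ) ω Q : ℝ) - _)]
      refine pow_le_pow_left₀ (by positivity) ?_ 2
      have h2 : (hitsIn t ℓ (c.setsUntil t θ) ω Q : ℝ) ≤ k := by exact_mod_cast hω.1
      linarith [hω.2]
  rw [div_le_iff₀ (by positivity)] at hk
  by_contra! hc
  have h1 : (ε * θ) ^ 2 * (δ / 3) < 11 * θ := by
    refine lt_of_lt_of_le (mul_lt_mul_of_pos_left hc (by positivity)) (h.trans ?_)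
    linarith
  have h2 : (ε * θ) ^ 2 * (δ / 3) = θ / 3 * (θ * (ε ^ 2 * δ)) := by ring
  have h3 : θ / 3 * 72 ≤ θ / 3 * (θ * (ε ^ 2 * δ)) :=
    mul_le_mul_of_nonneg_left (hk.trans (mul_le_mul_of_nonneg_right hkθ (by positivity)))
      (by positivity)
  linarith

end SecondMomentTails

end ReversibleChain

/-! ### The concentration hypothesis -/

/-- With `L ≥ 1` the ratio `τ̄ / E N` is at most one, so the rate of the hypothesis becomes a plain
`η`. -/
lemma VisitsConcentrate.exists_lower_bound {𝒞 : Set TargetChain} {τbar : TargetChain → ℝ}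
    (h : VisitsConcentrate 𝒞 τbar) (hpos : ∀ X ∈ 𝒞, 0 < τbar X) :
    ∃ c₁ > (0 : ℝ), ∀ η > (0 : ℝ), ∃ L : ℝ, 1 ≤ L ∧ ∀ X ∈ 𝒞, L ≤ X.n → ∀ T : ℕ,
      L * τbar X ≤ X.visits T →
        X.chain.pr T (fun _ => X.target) (fun ω => (vis ω T).card < c₁ * X.visits T) ≤ η := by
  obtain ⟨c₁, hc₁, c₂, -, h⟩ := h
  refine ⟨c₁, hc₁, fun η hη => ?_⟩
  obtain ⟨L, hL⟩ := h η hη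
  refine ⟨max L 1, le_max_right _ _, fun X hX hn T hT => ?_⟩
  have hτ := hpos X hX
  have h1 : L * τbar X ≤ X.visits T :=
    (mul_le_mul_of_nonneg_right (le_max_left L 1) hτ.le).trans hT
  have h2 : τbar X ≤ X.visits T := by
    have := (mul_le_mul_of_nonneg_right (le_max_right L 1) hτ.le).trans hT
    linarith
  have h3 := hL X hX ((le_max_left L 1).trans hn) T h1
  rw [ReversibleChain.prob_walk] at h3
  refine (X.chain.pr_mono fun ω hω => ?_).trans (h3.trans ?_)
  · exact fun hc => absurd hc.1 (not_le.2 hω)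
  · exact mul_le_of_le_one_right hη.le (div_le_one_of_le₀ h2 (hτ.le.trans h2))

lemma Scheme.achieves_of_forall {A : Scheme} {𝒞 : Set TargetChain} {τbar : TargetChain → ℝ}
    (h : ∀ ε ∈ Set.Ioo (0 : ℝ) 1, ∀ δ ∈ Set.Ioo (0 : ℝ) 1, ∃ F : ℝ, ∀ X ∈ 𝒞,
      1 - δ ≤ (A X.n X.chain.mixingTime ε δ X.target).prob X.chain X.target
        (fun x S => ((1 - ε) * X.chain.π X.target ≤ x ∧ x ≤ (1 + ε) * X.chain.π X.target) ∧
          (S.card : ℝ) ≤ F * X.budget (τbar X))) : A.Achieves 𝒞 τbar := by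
  choose! f hf using h
  exact ⟨f, hf⟩

/-! ### FullMassApprox -/

/-- The dictionary before the first step. -/
lemma ReversibleChain.dict_zero {V : Type} [Fintype V] [DecidableEq V] (c : ReversibleChain V)
    (v : V) : c.dict v (fun _ => v) 0 = Function.update (fun _ => none) v (some 1) := by
  funext x
  by_cases hx : x = v
  · subst hx
    simp [dict, vis_zero, (c.π_pos x).ne']
  · simp [dict, vis_zero, hx]

lemma isLocal_fullMassApproxScheme (κ : ℝ → ℝ → ℝ) : (fullMassApproxScheme κ).IsLocal := by
  intro n τ ε δ v
  refine isLocal_outer _ _ _ _ _ _ _ _ _ (Finset.mem_singleton_self v) fun x hx => ?_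
  by_contra hne
  rw [Finset.mem_singleton] at hne
  simp [Function.update_of_ne hne] at hx

lemma TargetChain.expect_fullMassApprox (X : TargetChain) (t : ℕ) (ε δ : ℝ)
    (g : ℝ → Finset (Fin X.n) → ℝ) :
    (FullMassApprox.alg t ε δ X.target).expect X.chain g {X.target} =
      X.chain.ex 0 ((X.n + FullMassApprox.threshold ε δ) * t) (fun _ => X.target)
        (X.chain.outcome X.target (FullMassApprox.threshold ε δ) t 0 g
          (X.n + FullMassApprox.threshold ε δ) 0) := by
  have h := X.chain.expect_outer g X.target (FullMassApprox.threshold ε δ) t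
    (X.n + FullMassApprox.threshold ε δ) 0 (fun _ => X.target)
  rw [zero_mul, vis_zero, X.chain.dict_zero, ReversibleChain.mass_zero, hits_zero, zero_div,
    ReversibleChain.setMass, Finset.sum_singleton, div_self (X.chain.π_pos _).ne', zero_add] at h
  rw [FullMassApprox.alg, Fintype.card_fin]
  exact h

/-- The threshold matches the rate `ε² / 8`: the factor `4` and the term `2 / ε²` suffice, since `4
(2 / ε²) (ε² / 8) = 1`. -/
lemma log_le_threshold_mul {ε δ : ℝ} (hε : ε ∈ Set.Ioo (0 : ℝ) 1) (hδ : δ ∈ Set.Ioo (0 : ℝ) 1) :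
    Real.log (3 / δ) ≤ FullMassApprox.threshold ε δ * (ε ^ 2 / 8) ∧
      0 < FullMassApprox.threshold ε δ := by
  obtain ⟨hε0, hε1⟩ := hε
  obtain ⟨hδ0, hδ1⟩ := hδ
  have hlog : 0 < Real.log (3 / δ) := Real.log_pos (by rw [lt_div_iff₀ hδ0]; linarith)
  set z := (2 + 4.4 * ε) / ε ^ 2 * Real.log (3 / δ) with hz
  have hz0 : 0 < z := by positivity
  have hzle : 2 / ε ^ 2 * Real.log (3 / δ) ≤ z :=
    mul_le_mul_of_nonneg_right (div_le_div_of_nonneg_right (by linarith) (by positivity)) hlog.le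
  have h1 := Nat.le_ceil z
  constructor
  · rw [FullMassApprox.threshold, ← hz]
    push_cast
    have h2 : 4 * (2 / ε ^ 2 * Real.log (3 / δ)) * (ε ^ 2 / 8) = Real.log (3 / δ) := by
      field_simp
      norm_num
    rw [← h2]
    exact mul_le_mul_of_nonneg_right (by linarith) (by positivity)
  · rw [FullMassApprox.threshold, ← hz]
    have := Nat.ceil_pos.2 hz0
    omega

/-- A sampling interval that makes the errors due to imperfect mixing negligible. -/
def samplingFactor (ε δ : ℝ) : ℝ := 3 + 20 * (1 + FullMassApprox.threshold ε δ)

/-- The error is halved `clog n + 10 (1 + k)` times, which beats `10 (n + k) ≤ n · 10 (1 + k)`. The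
`3` comes from `clog_two_le`, the `20` from `ln n ≥ 1/2`. -/
lemma TargetChain.mul_mixErr_le (X : TargetChain) (k : ℕ) {t : ℕ}
    (ht : (3 + 20 * (1 + k)) * X.chain.mixingTime * Real.log X.n ≤ t) :
    (X.n + k : ℕ) * X.chain.mixErr t ≤ 1 / 10 := by
  set m := Nat.clog 2 X.n + 10 * (1 + k) with hm
  have hτ1 := X.one_le_mixingTime
  have hτ0 : 0 < X.chain.mixingTime := by exact_mod_cast hτ1
  have hmlog : (m : ℝ) ≤ (3 + 20 * (1 + k)) * Real.log X.n := by
    rw [hm]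
    push_cast
    have h1 := clog_two_le X.two_le
    have h2 : (10 * (1 + k) : ℝ) ≤ 20 * (1 + k) * Real.log X.n := by
      have := mul_le_mul_of_nonneg_left X.half_le_log (show (0 : ℝ) ≤ 20 * (1 + k) by positivity)
      linarith
    linarith
  have hmt : m * X.chain.mixingTime ≤ t := by
    have : (m : ℝ) * X.chain.mixingTime ≤ t := by
      refine (mul_le_mul_of_nonneg_right hmlog (by linarith)).trans (le_of_eq_of_le ?_ ht)
      ring
    exact_mod_cast this
  have h1 : X.chain.mixErr t ≤ (1 / 2) ^ m := by
    refine (X.chain.mixErr_anti hmt).trans (le_of_eq ?_)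
    rw [ReversibleChain.mixErr, Nat.mul_div_cancel _ hτ0]
  have h2 : 10 * (X.n + k) ≤ 2 ^ m := by
    have h3 : X.n ≤ 2 ^ Nat.clog 2 X.n := Nat.le_pow_clog (by norm_num) _
    have h4 : 10 * (1 + k) < 2 ^ (10 * (1 + k)) := Nat.lt_two_pow_self
    calc 10 * (X.n + k) ≤ X.n * (10 * (1 + k)) := by nlinarith [X.two_le]
      _ ≤ 2 ^ m := by rw [hm, pow_add]; exact Nat.mul_le_mul h3 h4.le
  have h2' : (10 * (X.n + k : ℕ) : ℝ) ≤ 2 ^ m := by exact_mod_cast h2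
  calc (X.n + k : ℕ) * X.chain.mixErr t ≤ (2 ^ m / 10) * (1 / 2) ^ m :=
        mul_le_mul (by linarith) h1 (X.chain.mixErr_nonneg t) (by positivity)
    _ = 1 / 10 := by rw [div_mul_eq_mul_div, ← mul_pow]; norm_num

theorem achieves_fullMassApproxScheme {𝒞 : Set TargetChain} {τbar : TargetChain → ℝ} {a : ℝ}
    (ha : 0 < a) (hτ : ∀ X ∈ 𝒞, a * ((X.chain.mixingTime : ℝ) * Real.log X.n) ≤ τbar X)
    (hconc : VisitsConcentrate 𝒞 τbar) : (fullMassApproxScheme samplingFactor).Achieves 𝒞 τbar := by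
  have hpos : ∀ X ∈ 𝒞, 0 < τbar X := fun X hX =>
    lt_of_lt_of_le (mul_pos ha (by linarith [X.half_le_mul_log])) (hτ X hX)
  obtain ⟨c₁, hc₁, hlow⟩ := hconc.exists_lower_bound hpos
  refine Scheme.achieves_of_forall fun ε hε δ hδ => ?_
  obtain ⟨hlog, hk⟩ := log_le_threshold_mul hε hδ
  -- The failure probability is split as `2/5 + 2/5 + 1/5`: two Chernoff tails and the number of
  -- visits.
  obtain ⟨L, hL1, hL⟩ := hlow (δ / 5 / 3) (by have := hδ.1; positivity)
  set k := FullMassApprox.threshold ε δ with hkdef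
  set κ := samplingFactor ε δ with hκ
  have hκ0 : 0 < κ := by rw [hκ, samplingFactor]; positivity
  have hε' : 0 < 1 - ε := sub_pos.2 hε.2
  have hkR : (0 : ℝ) < k := by exact_mod_cast hk
  -- Rounding up costs at most `1 ≤ 2 τ ln n`, so `t ≤ (κ + 2) τ ln n`, and the factor `1 / a`
  -- converts this into a multiple of `τ̄`.
  obtain ⟨F, hF⟩ := TargetChain.exists_visits_bound (δ := δ / 5) (c₁ := c₁)
    (A := (κ + 2) * (1 + 1 / a)) (K := k / (1 - ε)) (L := L) (by have := hδ.1; positivity) hc₁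
    (by positivity) (by positivity) hL1
  refine ⟨F, fun X hX => ?_⟩
  have hm := X.half_le_mul_log
  set μ := X.chain.mixingTime * Real.log X.n with hμ
  set t := ⌈κ * X.chain.mixingTime * Real.log X.n⌉₊ with ht
  have hκμ : κ * X.chain.mixingTime * Real.log X.n = κ * μ := by rw [hμ, mul_assoc]
  have ht0 : 0 < t := Nat.ceil_pos.2 (by rw [hκμ]; exact mul_pos hκ0 (by linarith))
  have htle : (t : ℝ) ≤ (κ + 2) * μ := by
    have := Nat.ceil_lt_add_one (show 0 ≤ κ * X.chain.mixingTime * Real.log X.n by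
      rw [hκμ]; exact (mul_pos hκ0 (by linarith)).le)
    rw [← ht, hκμ] at this
    linarith
  have hκμ0 : 0 ≤ (κ + 2) * μ := mul_nonneg (by linarith) (by linarith)
  have hvis := hF X (τbar X) t 0 (X.n + k) (hpos X hX) ht0 ?_ ?_ (fun hn T hT => hL X hX hn T hT)
  · have herr : (X.n + k : ℕ) * X.chain.mixErr t ≤ 1 / 10 := X.mul_mixErr_le k (Nat.le_ceil _)
    have h1 := X.chain.pr_le_hitsIn_setsBelow_le (v := X.target) hlog hδ.1 hε.2 hε.1 herr
    have h2 := X.chain.pr_hitsIn_setsUntil_le (v := X.target) hlog hδ.1 hε.2 hε.1 herr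
    have h := X.chain.le_ex_outcome (v := X.target) (ℓ := 0) (t := t) hk
      (show X.n + k = (0 + 1) * (Fintype.card (Fin X.n) + k) by simp) hε.1 hε.2
      (g := fun x S => @ite ℝ _ (Classical.propDecidable (((1 - ε) * X.chain.π X.target ≤ x ∧
        x ≤ (1 + ε) * X.chain.π X.target) ∧ (S.card : ℝ) ≤ F * X.budget (τbar X))) 1 0)
      (fun x S => by split_ifs <;> norm_num) (fun x S hx => if_pos hx) h1 h2 hvis
    refine le_trans (by linarith) (h.trans (le_of_eq ?_))
    exact (X.expect_fullMassApprox t ε δ _).symm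
  · have h1 : (κ + 2) * μ ≤ (κ + 2) * (1 / a * τbar X) := by
      refine mul_le_mul_of_nonneg_left ?_ (by linarith)
      rw [one_div, ← div_eq_inv_mul, le_div_iff₀ ha, mul_comm]
      exact hτ X hX
    have h2 : 0 < (κ + 2) * τbar X := mul_pos (by linarith) (hpos X hX)
    linarith
  · have h1 : 0 ≤ (κ + 2) * μ * (1 / a) := mul_nonneg hκμ0 (by positivity)
    push_cast
    linarith

/-! ### The scheme with lagged samples -/

/-- The number of hits after which the lagged scheme halts. -/
def laggedThreshold (ε δ : ℝ) : ℕ := ⌈72 / (ε ^ 2 * δ)⌉₊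

/-- Half the lag between a sample and the set against which it is tested, in units of `τ`. -/
def halfLag (n k : ℕ) : ℕ := 6 * (k + 136) + 8 * Nat.clog 2 n

lemma halfLag_pos (n k : ℕ) : 0 < halfLag n k := by unfold halfLag; omega

/-- The scheme that takes a sample every `τ` steps and tests it against the set of states visited
`2 * halfLag` samples before. -/
def laggedScheme : Scheme := fun n τ ε δ v =>
  laggedOuter (laggedThreshold ε δ) τ (2 * halfLag n (laggedThreshold ε δ) - 1)
    (2 * halfLag n (laggedThreshold ε δ) * (n + laggedThreshold ε δ) +
      (2 * halfLag n (laggedThreshold ε δ) - 1)) 0 (fun _ => {v})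
    (Function.update (fun _ => none) v (some 1)) (fun _ => v)

lemma isLocal_laggedScheme : laggedScheme.IsLocal := by
  intro n τ ε δ v
  refine isLocal_laggedOuter _ _ _ _ 0 (fun _ => {v}) _ (fun _ => v)
    (Finset.mem_singleton_self v) fun x hx => ?_
  by_contra hne
  rw [Finset.mem_singleton] at hne
  simp [Function.update_of_ne hne] at hx

/-- Makes the residual correlations of all pairs of samples add up to at most one. The number of
samples itself contains the lag, but only polynomially, so a lag logarithmic in `n` suffices. -/
lemma sq_le_two_pow_halfLag {n : ℕ} (hn : 1 ≤ n) (k : ℕ) :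
    2 * (2 * halfLag n k * (n + k)) ^ 2 ≤ 2 ^ halfLag n k := by
  set l := Nat.clog 2 n with hl
  set m := k + 136 with hm
  have h1 : n ≤ 2 ^ l := Nat.le_pow_clog (by norm_num) _
  have h2 : l + 1 ≤ 2 ^ l := Nat.lt_two_pow_self
  have h3 : m + 1 ≤ 2 ^ m := Nat.lt_two_pow_self
  have h4 : halfLag n k ≤ 8 * (m + 1) * 2 ^ l := by
    rw [halfLag, ← hl, ← hm]
    nlinarith
  have h5 : n + k ≤ 2 ^ l * (m + 1) := by nlinarith
  have h6 : 2 * halfLag n k * (n + k) ≤ 16 * (m + 1) ^ 2 * (2 ^ l) ^ 2 := by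
    calc 2 * halfLag n k * (n + k) ≤ 2 * (8 * (m + 1) * 2 ^ l) * (2 ^ l * (m + 1)) :=
          Nat.mul_le_mul (Nat.mul_le_mul_left 2 h4) h5
      _ = _ := by ring
  have h7 : 512 ≤ (m + 1) ^ 2 := by nlinarith
  calc 2 * (2 * halfLag n k * (n + k)) ^ 2 ≤ 2 * (16 * (m + 1) ^ 2 * (2 ^ l) ^ 2) ^ 2 :=
        Nat.mul_le_mul_left 2 (Nat.pow_le_pow_left h6 2)
    _ = 512 * ((m + 1) ^ 4 * (2 ^ l) ^ 4) := by ring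
    _ ≤ (m + 1) ^ 2 * ((m + 1) ^ 4 * (2 ^ l) ^ 4) := Nat.mul_le_mul_right _ h7
    _ = (m + 1) ^ 6 * (2 ^ l) ^ 4 := by ring
    _ ≤ (2 ^ m) ^ 6 * (2 ^ l) ^ 8 :=
        Nat.mul_le_mul (Nat.pow_le_pow_left h3 6) (Nat.pow_le_pow_right (by positivity) (by norm_num))
    _ = 2 ^ halfLag n k := by
        rw [← pow_mul, ← pow_mul, ← pow_add, halfLag, mul_comm m, mul_comm l]

theorem achieves_laggedScheme {𝒞 : Set TargetChain} {τbar : TargetChain → ℝ} {a : ℝ}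
    (ha : 0 < a) (hτ : ∀ X ∈ 𝒞, a * (X.chain.mixingTime : ℝ) ≤ τbar X)
    (hconc : VisitsConcentrate 𝒞 τbar) : laggedScheme.Achieves 𝒞 τbar := by
  have hpos : ∀ X ∈ 𝒞, 0 < τbar X := fun X hX =>
    lt_of_lt_of_le (mul_pos ha (by linarith [X.one_le_mixingTime])) (hτ X hX)
  obtain ⟨c₁, hc₁, hlow⟩ := hconc.exists_lower_bound hpos
  refine Scheme.achieves_of_forall fun ε hε δ hδ => ?_
  obtain ⟨hε0, hε1⟩ := hε
  obtain ⟨hδ0, hδ1⟩ := hδ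
  set k := laggedThreshold ε δ with hkdef
  have hkle : 72 / (ε ^ 2 * δ) ≤ k := Nat.le_ceil _
  have hk : 0 < k := Nat.ceil_pos.2 (by positivity)
  have hkR : (0 : ℝ) < k := by exact_mod_cast hk
  have hε' : 0 < 1 - ε := by linarith
  obtain ⟨L, hL1, hL⟩ := hlow (δ / 3 / 3) (by positivity)
  -- The summand `1 / a` gives `τ ≤ A τ̄` for the interval, and `24 (k + 140)` bounds the lag of `2
  -- M` intervals by `A τ ln n`.
  obtain ⟨F, hF⟩ := TargetChain.exists_visits_bound (δ := δ / 3) (c₁ := c₁)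
    (A := 24 * (k + 140) + 1 / a) (K := k / (1 - ε)) (L := L) (by positivity) hc₁
    (by positivity) (by positivity) hL1
  refine ⟨F, fun X hX => ?_⟩
  set c := X.chain
  set t := c.mixingTime with ht
  have hτ1 := X.one_le_mixingTime
  have ht0 : 0 < t := by exact_mod_cast hτ1
  set M := halfLag X.n k with hM
  have hM0 : 0 < M := halfLag_pos _ _
  set ℓ := 2 * M - 1 with hℓ
  have hℓM : ℓ + 1 = 2 * M := by omega
  set Q := 2 * M * (X.n + k) with hQdef
  have hvis := hF X (τbar X) t ℓ Q (hpos X hX) ht0 ?_ ?_ (fun hn T hT => hL X hX hn T hT)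
  · have hmix : ∀ s, c.mixErr (s * t) ≤ (1 / 2) ^ s := fun s => by
      rw [ReversibleChain.mixErr, Nat.mul_div_cancel _ ht0]
    have hQ : 2 * (Q : ℝ) ^ 2 * (1 / 2) ^ M ≤ 1 := by
      have h1 : 2 * (Q : ℝ) ^ 2 ≤ 2 ^ M := by
        exact_mod_cast sq_le_two_pow_halfLag (by have := X.two_le; omega) k
      calc 2 * (Q : ℝ) ^ 2 * (1 / 2) ^ M ≤ 2 ^ M * (1 / 2) ^ M :=
            mul_le_mul_of_nonneg_right h1 (by positivity)
        _ = 1 := by rw [← mul_pow]; norm_num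
    have h1 := c.pr_le_hitsIn_setsBelow_le' (v := X.target) hℓM hmix hQ hkle hk hδ0 hε1 hε0
    have h2 := c.pr_hitsIn_setsUntil_le' (v := X.target) hℓM hmix hQ hkle hk hδ0 hε1 hε0
    have h := c.le_ex_outcome (v := X.target) (ℓ := ℓ) (t := t) hk
      (show Q = (ℓ + 1) * (Fintype.card (Fin X.n) + k) by rw [hℓM, Fintype.card_fin]) hε0 hε1
      (g := fun x S => @ite ℝ _ (Classical.propDecidable (((1 - ε) * c.π X.target ≤ x ∧
        x ≤ (1 + ε) * c.π X.target) ∧ (S.card : ℝ) ≤ F * X.budget (τbar X))) 1 0)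
      (fun x S => by split_ifs <;> norm_num) (fun x S hx => if_pos hx) h1 h2 hvis
    refine le_trans (by linarith) (h.trans (le_of_eq ?_))
    have he := fun g => c.expect_laggedOuter g X.target k t ℓ (Q + ℓ) 0 (fun _ => X.target)
      (fun _ => {X.target}) (fun _ => X.target)
      (fun i hi => by rw [Nat.le_zero.1 hi, zero_mul, vis_zero]) (fun _ _ => rfl)
    simp only [zero_mul, vis_zero, c.dict_zero, zero_add] at he
    exact (he _).symm
  · have h1 : (t : ℝ) ≤ 1 / a * τbar X := by
      rw [one_div, ← div_eq_inv_mul, le_div_iff₀ ha, mul_comm]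
      exact hτ X hX
    have h2 : 0 < 24 * (k + 140) * τbar X := mul_pos (by positivity) (hpos X hX)
    linarith
  · have h1 : (M : ℝ) ≤ 12 * (k + 140) * Real.log X.n := by
      rw [hM, halfLag]
      push_cast
      have h2 := clog_two_le X.two_le
      have h3 := mul_le_mul_of_nonneg_left X.half_le_log (show (0 : ℝ) ≤ 12 * (k + 136) by positivity)
      have h4 := X.half_le_log
      linarith
    have h2 : ((ℓ : ℝ) + 1) = 2 * M := by exact_mod_cast hℓM
    have h3 : 0 ≤ 1 / a * (t * Real.log X.n) := by
      have := X.half_le_mul_log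
      exact mul_nonneg (by positivity) (by linarith)
    have h4 := mul_le_mul_of_nonneg_right h1 (show (0 : ℝ) ≤ t by positivity)
    rw [h2]
    linarith

end

theorem theorem4 :
    -- the bound, for `τ̄ = Ω(τ)`, by one scheme for all classes of chains
    (∃ A : Scheme, A.IsLocal ∧
      ∀ (𝒞 : Set TargetChain) (τbar : TargetChain → ℝ),
        (∃ a > (0 : ℝ), ∀ X ∈ 𝒞, a * (X.chain.mixingTime : ℝ) ≤ τbar X) →
        VisitsConcentrate 𝒞 τbar → A.Achieves 𝒞 τbar) ∧
    -- FullMassApprox achieves it, for `τ̄ = Ω(τ ln n)`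
    (∃ κ : ℝ → ℝ → ℝ, (fullMassApproxScheme κ).IsLocal ∧
      ∀ (𝒞 : Set TargetChain) (τbar : TargetChain → ℝ),
        (∃ a > (0 : ℝ), ∀ X ∈ 𝒞,
          a * ((X.chain.mixingTime : ℝ) * Real.log X.n) ≤ τbar X) →
        VisitsConcentrate 𝒞 τbar → (fullMassApproxScheme κ).Achieves 𝒞 τbar) :=
  ⟨⟨laggedScheme, isLocal_laggedScheme, fun _ _ ⟨_, ha, hτ⟩ hconc =>
      achieves_laggedScheme ha hτ hconc⟩,
    ⟨samplingFactor, isLocal_fullMassApproxScheme _, fun _ _ ⟨_, ha, hτ⟩ hconc =>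
      achieves_fullMassApproxScheme ha hτ hconc⟩⟩
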